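/- Consider two clients sharing one access point, with integer inter-delivery thresholds $\tau_1=\tau\ge 2$ and $\tau_2=\tau+\Delta$, $\Delta\ge 0$, and channel reliabilities $p_n=1-b_n\epsilon$, where $b_1,b_2>0$ are fixed and $\epsilon>0$ is small (so that $p_n\in(0,1)$). The state space is $\mathbb{Y}=\{0,\dots,\tau_1\}\times\{0,\dots,\tau_2\}$. In every slot one client $u\in\{1,2\}$ is scheduled; from the state $\mathbf{x}=(x_1,x_2)$, with probability $p_u$ the transmission succeeds, $x_u$ is replaced by $0$ and the other coordinate $x_m$ by $\min\{x_m+1,\tau_m\}$; with probability $1-p_u$ it fails and each $x_n$ is replaced by $\min\{x_n+1,\tau_n\}$. A stationary policy is a map $f:\mathbb{Y}\to\{1,2\}$; under $f$ client $f(\mathbf{x})$ is scheduled in state $\mathbf{x}$, and $Y(t)$ denotes the resulting Markov chain. For fixed $\theta>0$ the risk-sensitive cost of $f$ is $$J(f,\mathbf{x})=\limsup_{T\to\infty}\frac{1}{\theta T}\ln \mathrm{E}_f\Big[\exp\Big(\theta\sum_{t=0}^{T-1}\sum_{n=1}^{2}\mathbf{1}\{Y_n(t)=\tau_n\}\Big)\,\Big|\,Y(0)=\mathbf{x}\Big],$$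 and $J^\star(\mathbf{x})=\min_f J(f,\mathbf{x})$, the minimum being over all stationary policies. The modified-least-time-to-go (MLG) policy $f^{\mathrm{MLG}}$ schedules client $2$ in the state $(0,\Delta-1)$ (if $\Delta\ge1$), and in every other state the client with the smallest $\tau_n-x_n$, ties being broken in favour of client $2$. Put $$A_0=\frac{e^\theta-1}{\theta}\sum_{j=1}^{\tau-2}b_1^jb_2^{\tau-1-j}+\frac{b_1^{\tau-1}+b_2^{\tau-1}}{2\theta}\,(e^{2\theta}-1),\qquad b_{\min}=\min\{b_1,b_2\},\qquad A_1=b_1^{\tau-1}+(\tau-1)b_{\min}^{\tau-1},$$ and, for $\Delta\ge2$, $$A_2=\min\Big\{\frac{b_1^{\tau-1}}{\Delta},\ \frac{b_1^{\tau-1}+(\tau-1)b_{\min}^{\tau-1}}{\Delta+1},\ \frac{b_1^{\tau-1}+(\tau-1)b_{\min}^{\tau-1}+\sum_{j=1}^{\tau-1}b_2^jb_1^{\tau-1-j}}{\Delta+2}\Big\}.$$ Then for every $\mathbf{x}\in\mathbb{Y}$, as $\epsilon\to0^+$ with $\theta,b_1,b_2,\tau,\Delta$ fixed: 1) $$J(f^{\mathrm{MLG}},\mathbf{x})=\begin{cases}A_0\,\epsilon^{\tau-1}+O(\epsilon^\tau)&\text{if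 }\Delta=0,\\[2pt] \dfrac{e^\theta-1}{2\theta}\,\epsilon^{\tau-1}\sum_{j=0}^{\tau-1}b_1^jb_2^{\tau-1-j}+O(\epsilon^\tau)&\text{if }\Delta=1,\\[2pt] \dfrac{e^\theta-1}{\theta\Delta}\,b_1^{\tau-1}\epsilon^{\tau-1}+O(\epsilon^\tau)&\text{if }\Delta\ge2.\end{cases}$$ 2) $$J^\star(\mathbf{x})\ \ge\ \begin{cases}A_0\,\epsilon^{\tau-1}+o(\epsilon^{\tau-1})&\text{if }\Delta=0,\\[2pt] \dfrac{e^\theta-1}{2\theta}\,A_1\,\epsilon^{\tau-1}+o(\epsilon^{\tau-1})&\text{if }\Delta=1,\\[2pt] \dfrac{e^\theta-1}{\theta}\,A_2\,\epsilon^{\tau-1}+o(\epsilon^{\tau-1})&\text{if }\Delta\ge2.\end{cases}$$ 3) The MLG policy is asymptotically optimal, that is, $J(f^{\mathrm{MLG}},\mathbf{x})/J^\star(\mathbf{x})\to1$ as $\epsilon\to0^+$, if any of the following holds: (i) $\Delta=0$; (ii) $\Delta=1$ and $b_1\le b_2$; (iii) $\Delta\ge2$ and $b_1^{\tau-1}\le\Delta(\tau-1)b_2^{\tau-1}$.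 -/

import Mathlib

open Filter Topology Asymptotics

noncomputable section

namespace InterDelivery

/-- The two clients; in each time slot exactly one of them is scheduled. -/
inductive Client
  | one
  | two

/-- System states: a pair `(x₁, x₂)` with `0 ≤ xₙ ≤ τₙ`, where `xₙ` is the time elapsed since the
last packet delivery of client `n`, truncated at the threshold `τₙ`. -/
abbrev State (τ₁ τ₂ : ℕ) : Type := Fin (τ₁ + 1) × Fin (τ₂ + 1)

/-- Stationary policies: the scheduled client is a function of the current state. -/
abbrev Policy (τ₁ τ₂ : ℕ) : Type := State τ₁ τ₂ → Client

/-- `i ↦ (i + 1) ∧ k`. -/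
def age {k : ℕ} (i : Fin (k + 1)) : Fin (k + 1) :=
  ⟨min ((i : ℕ) + 1) k, Nat.lt_succ_of_le (min_le_right _ _)⟩

variable {τ₁ τ₂ : ℕ}

/-- The next state if the transmission of the scheduled client succeeds. -/
def afterSuccess : Client → State τ₁ τ₂ → State τ₁ τ₂
  | .one, x => (0, age x.2)
  | .two, x => (age x.1, 0)

/-- The next state if the transmission fails. -/
def afterFailure (x : State τ₁ τ₂) : State τ₁ τ₂ := (age x.1, age x.2)

/-- The probability of moving from `x` to `y` when client `u` is scheduled and the channel
reliabilities are `p`. -/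
def transProb (p : Client → ℝ) (u : Client) (x y : State τ₁ τ₂) : ℝ :=
  (if y = afterSuccess u x then p u else 0) + (if y = afterFailure x then 1 - p u else 0)

/-- The number of clients whose elapsed time has reached the threshold in state `x`. -/
def violations (x : State τ₁ τ₂) : ℕ :=
  (if (x.1 : ℕ) = τ₁ then 1 else 0) + (if (x.2 : ℕ) = τ₂ then 1 else 0)

/-- The probability, under the stationary policy `f` and with `Y(0) = x`, that
`(Y(0), …, Y(T)) = y`. -/
def pathProb (p : Client → ℝ) (f : Policy τ₁ τ₂) (T : ℕ) (x : State τ₁ τ₂)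
    (y : Fin (T + 1) → State τ₁ τ₂) : ℝ :=
  if y 0 = x then ∏ t : Fin T, transProb p (f (y t.castSucc)) (y t.castSucc) (y t.succ) else 0

/-- The `T`-horizon cost `E_f[exp(θ ∑_{t<T} ∑ₙ 1{Yₙ(t) = τₙ}) | Y(0) = x]`, the expectation being
taken with respect to the law of `(Y(0), …, Y(T))`. -/
def horizonCost (θ : ℝ) (p : Client → ℝ) (f : Policy τ₁ τ₂) (T : ℕ) (x : State τ₁ τ₂) : ℝ :=
  ∑ y : Fin (T + 1) → State τ₁ τ₂,
    pathProb p f T x y * Real.exp (θ * ∑ t : Fin T, (violations (y t.castSucc) : ℝ))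

/-- The risk-sensitive average cost `J(f, x) = limsup_T (1/θ) (1/T) ln V_T^f(x)`. -/
def avgCost (θ : ℝ) (p : Client → ℝ) (f : Policy τ₁ τ₂) (x : State τ₁ τ₂) : ℝ :=
  limsup (fun T : ℕ => 1 / θ * (1 / (T : ℝ)) * Real.log (horizonCost θ p f T x)) atTop

/-- The optimal cost over all stationary policies (an infimum over a finite set, so a minimum). -/
def optCost (θ : ℝ) (p : Client → ℝ) (x : State τ₁ τ₂) : ℝ :=
  ⨅ f : Policy τ₁ τ₂, avgCost θ p f x

/-- The modified-least-time-to-go policy for the thresholds `τ` and `τ + Δ`: client 2 in the state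
`(0, Δ - 1)` (which exists only if `Δ ≥ 1`); otherwise the client with the least `τₙ - xₙ`,
ties being broken in favour of client 2. -/
def mlg (τ Δ : ℕ) : Policy τ (τ + Δ) := fun x =>
  if (x.1 : ℕ) = 0 ∧ (x.2 : ℕ) + 1 = Δ then .two
  else if τ + Δ - (x.2 : ℕ) ≤ τ - (x.1 : ℕ) then .two
  else .one

/-- The channel reliabilities `pₙ = 1 - bₙ ε`. -/
def reliability (b₁ b₂ ε : ℝ) : Client → ℝ
  | .one => 1 - b₁ * ε
  | .two => 1 - b₂ * ε

/-- The leading coefficient for equal thresholds. -/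
def A₀ (θ b₁ b₂ : ℝ) (τ : ℕ) : ℝ :=
  (Real.exp θ - 1) / θ * ∑ j ∈ Finset.Icc 1 (τ - 2), b₁ ^ j * b₂ ^ (τ - 1 - j)
    + (b₁ ^ (τ - 1) + b₂ ^ (τ - 1)) / (2 * θ) * (Real.exp (2 * θ) - 1)

def A₁ (b₁ b₂ : ℝ) (τ : ℕ) : ℝ :=
  b₁ ^ (τ - 1) + ((τ : ℝ) - 1) * (min b₁ b₂) ^ (τ - 1)

def A₂ (b₁ b₂ : ℝ) (τ Δ : ℕ) : ℝ :=
  min (b₁ ^ (τ - 1) / Δ)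
    (min ((b₁ ^ (τ - 1) + ((τ : ℝ) - 1) * (min b₁ b₂) ^ (τ - 1)) / (Δ + 1))
      ((b₁ ^ (τ - 1) + ((τ : ℝ) - 1) * (min b₁ b₂) ^ (τ - 1)
        + ∑ j ∈ Finset.Icc 1 (τ - 1), b₂ ^ j * b₁ ^ (τ - 1 - j)) / (Δ + 2)))

/-- The leading coefficient of the cost of the MLG policy. -/
def mlgCoeff (θ b₁ b₂ : ℝ) (τ Δ : ℕ) : ℝ :=
  if Δ = 0 then A₀ θ b₁ b₂ τ
  else if Δ = 1 then
    (Real.exp θ - 1) / (2 * θ) * ∑ j ∈ Finset.range τ, b₁ ^ j * b₂ ^ (τ - 1 - j)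
  else (Real.exp θ - 1) / (θ * Δ) * b₁ ^ (τ - 1)

/-- The leading coefficient of the lower bound on the optimal cost. -/
def lowerCoeff (θ b₁ b₂ : ℝ) (τ Δ : ℕ) : ℝ :=
  if Δ = 0 then A₀ θ b₁ b₂ τ
  else if Δ = 1 then (Real.exp θ - 1) / (2 * θ) * A₁ b₁ b₂ τ
  else (Real.exp θ - 1) / θ * A₂ b₁ b₂ τ Δ

end InterDelivery

end

/-! Put q = τ - 2. Each failure has probability of order ε, so the finite-horizon cost expands in
powers of ε, and its leading coefficient is a sum over paths with as few failures as can cause a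
violation. `lead` is this sum. It always bounds the cost from below (`exists_lead_le_value`), and it
is exact from a state where fewer failures are harmless (`Safe.value_isBigO`).

From a starting state, either some k ≤ q failures already cause a violation, which costs order ε^k
and outweighs ε^(q+1), or the schedule along the success path is severely restricted. A client with
no spare slot must be served, so the success path enters a cycle (1,0), (0,1), …, (0,k), back to
(1,0), with 1 ≤ k ≤ Δ + 1. Failure runs branching off the cycle contribute a critical weight per
period, bounded below in `Safe.exists_period`. Where both clients compete, the weight is a complete
homogeneous polynomial in b₁, b₂: its two recursions correspond to the two possible scheduling
decisions, so the decision does not matter. If β is at most weight divided by length for every such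
cycle (`IsCycleRate`), then `lead` grows at least like β times the horizon. As there are finitely
many policies and states, one long horizon serves them all, and `le_avgCost` gives the bound on the
optimal cost (`eventually_le_optCost`).

MLG follows the cycle with k = max(1, Δ - 1), where the weights can be computed exactly
(`lead_mlg_period`). The resulting growth factor 1 + κ ε^(q+1) + O(ε^(q+2)) at (1,0) spreads to
every state because all success paths reach (1,0) (`growthError_isBigO_of_iterate`). A uniform
growth factor over one period determines the average cost to that order. Asymptotic optimality is
then the statement that the MLG ratio is itself a valid β (`isCycleRate_mlg`), followed by a
squeeze. -/

noncomputable section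

namespace InterDelivery

/-! ### Untruncated dynamics and critical weights -/

/-- The failure rates: client `u` fails with probability `rate b₁ b₂ u * ε`. -/
def rate (b₁ b₂ : ℝ) : Client → ℝ
  | .one => b₁
  | .two => b₂

lemma rate_pos {b₁ b₂ : ℝ} (hb₁ : 0 < b₁) (hb₂ : 0 < b₂) (u : Client) : 0 < rate b₁ b₂ u := by
  cases u <;> assumption

/-- The untruncated elapsed times after a successful transmission. -/
def hit : Client → ℕ × ℕ → ℕ × ℕ
  | .one, z => (0, z.2 + 1)
  | .two, z => (z.1 + 1, 0)

/-- The untruncated elapsed times after a failed transmission. -/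
def miss (z : ℕ × ℕ) : ℕ × ℕ := (z.1 + 1, z.2 + 1)

/-- The number of clients that have reached their threshold. -/
def overdue (τ₁ τ₂ : ℕ) (z : ℕ × ℕ) : ℕ :=
  (if τ₁ ≤ z.1 then 1 else 0) + (if τ₂ ≤ z.2 then 1 else 0)

/-- The expected exponential cost over `m` slots, by first-step recursion on untruncated
elapsed times. -/
def value (θ : ℝ) (b : Client → ℝ) (τ₁ τ₂ : ℕ) (g : ℕ × ℕ → Client) (ε : ℝ) : ℕ → ℕ × ℕ → ℝ
  | 0, _ => 1
  | m + 1, z => Real.exp (θ * overdue τ₁ τ₂ z) *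
      ((1 - b (g z) * ε) * value θ b τ₁ τ₂ g ε m (hit (g z) z)
        + b (g z) * ε * value θ b τ₁ τ₂ g ε m (miss z))

/-- The contribution of the sample paths with exactly `k` failures to the coefficient of `ε ^ k`
in `value - 1`. -/
def lead (θ : ℝ) (b : Client → ℝ) (τ₁ τ₂ : ℕ) (g : ℕ × ℕ → Client) : ℕ → ℕ → ℕ × ℕ → ℝ
  | 0, _, _ => 0
  | m + 1, 0, z => Real.exp (θ * overdue τ₁ τ₂ z) * (1 + lead θ b τ₁ τ₂ g m 0 (hit (g z) z)) - 1
  | m + 1, k + 1, z => lead θ b τ₁ τ₂ g m (k + 1) (hit (g z) z)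
      + b (g z) * lead θ b τ₁ τ₂ g m k (miss z)

/-- Fewer than `k` failures never lead to a violation. -/
def Safe (θ : ℝ) (b : Client → ℝ) (τ₁ τ₂ : ℕ) (g : ℕ × ℕ → Client) (k : ℕ) (z : ℕ × ℕ) : Prop :=
  ∀ m, ∀ j < k, lead θ b τ₁ τ₂ g m j z = 0

/-! ### Monotonicity of critical weights and consequences of safety -/

section lead
variable {θ : ℝ} {b : Client → ℝ} {τ₁ τ₂ : ℕ} {g : ℕ × ℕ → Client}

lemma lead_succ_zero (m : ℕ) (z : ℕ × ℕ) : lead θ b τ₁ τ₂ g (m + 1) 0 z =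
    Real.exp (θ * overdue τ₁ τ₂ z) * (1 + lead θ b τ₁ τ₂ g m 0 (hit (g z) z)) - 1 := by
  rw [lead]

lemma lead_succ_succ (m k : ℕ) (z : ℕ × ℕ) : lead θ b τ₁ τ₂ g (m + 1) (k + 1) z =
    lead θ b τ₁ τ₂ g m (k + 1) (hit (g z) z) + b (g z) * lead θ b τ₁ τ₂ g m k (miss z) := by
  rw [lead]

lemma one_le_exp_overdue (hθ : 0 < θ) (z : ℕ × ℕ) : 1 ≤ Real.exp (θ * overdue τ₁ τ₂ z) :=
  Real.one_le_exp (by positivity)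

lemma exp_le_exp_overdue (hθ : 0 < θ) {z : ℕ × ℕ} (hz : τ₁ ≤ z.1 ∨ τ₂ ≤ z.2) :
    Real.exp θ ≤ Real.exp (θ * overdue τ₁ τ₂ z) := by
  apply Real.exp_le_exp.2
  have : (1 : ℝ) ≤ overdue τ₁ τ₂ z := by
    have : 1 ≤ overdue τ₁ τ₂ z := by unfold overdue; grind
    exact_mod_cast this
  nlinarith

lemma lead_nonneg (hθ : 0 < θ) (hb : ∀ u, 0 < b u) (m k : ℕ) (z : ℕ × ℕ) :
    0 ≤ lead θ b τ₁ τ₂ g m k z := by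
  induction m generalizing k z with
  | zero => simp [lead]
  | succ m ih =>
    cases k with
    | zero =>
      rw [lead_succ_zero]
      nlinarith [one_le_exp_overdue (τ₁ := τ₁) (τ₂ := τ₂) hθ z, ih 0 (hit (g z) z)]
    | succ k =>
      rw [lead_succ_succ]
      exact add_nonneg (ih _ _) (mul_nonneg (hb _).le (ih _ _))

lemma lead_le_succ (hθ : 0 < θ) (hb : ∀ u, 0 < b u) (m k : ℕ) (z : ℕ × ℕ) :
    lead θ b τ₁ τ₂ g m k z ≤ lead θ b τ₁ τ₂ g (m + 1) k z := by
  induction m generalizing k z with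
  | zero => simpa [lead] using lead_nonneg hθ hb 1 k z
  | succ m ih =>
    cases k with
    | zero =>
      rw [lead_succ_zero, lead_succ_zero]
      gcongr
      exact ih _ _
    | succ k =>
      rw [lead_succ_succ, lead_succ_succ]
      exact add_le_add (ih _ _) (mul_le_mul_of_nonneg_left (ih _ _) (hb _).le)

lemma lead_mono (hθ : 0 < θ) (hb : ∀ u, 0 < b u) (k : ℕ) (z : ℕ × ℕ) :
    Monotone fun m => lead θ b τ₁ τ₂ g m k z :=
  monotone_nat_of_le_succ fun m => lead_le_succ hθ hb m k z

lemma lead_hit_le (hθ : 0 < θ) (hb : ∀ u, 0 < b u) (m k : ℕ) (z : ℕ × ℕ) :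
    lead θ b τ₁ τ₂ g m k (hit (g z) z) ≤ lead θ b τ₁ τ₂ g (m + 1) k z := by
  cases k with
  | zero =>
    rw [lead_succ_zero]
    nlinarith [one_le_exp_overdue (τ₁ := τ₁) (τ₂ := τ₂) hθ z,
      lead_nonneg (τ₁ := τ₁) (τ₂ := τ₂) (g := g) hθ hb m 0 (hit (g z) z)]
  | succ k =>
    rw [lead_succ_succ]
    exact le_add_of_nonneg_right (mul_nonneg (hb _).le (lead_nonneg hθ hb _ _ _))

lemma lead_zero_of_overdue (hθ : 0 < θ) (hb : ∀ u, 0 < b u) {z : ℕ × ℕ}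
    (hz : τ₁ ≤ z.1 ∨ τ₂ ≤ z.2) {m : ℕ} (hm : 0 < m) :
    Real.exp θ - 1 ≤ lead θ b τ₁ τ₂ g m 0 z := by
  obtain ⟨m, rfl⟩ := Nat.exists_eq_succ_of_ne_zero hm.ne'
  rw [lead_succ_zero]
  nlinarith [exp_le_exp_overdue hθ hz, Real.exp_pos θ,
    lead_nonneg (τ₁ := τ₁) (τ₂ := τ₂) (g := g) hθ hb m 0 (hit (g z) z)]

lemma Safe.hit (hθ : 0 < θ) (hb : ∀ u, 0 < b u) {k : ℕ} {z : ℕ × ℕ}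
    (h : Safe θ b τ₁ τ₂ g k z) : Safe θ b τ₁ τ₂ g k (hit (g z) z) := fun m j hj =>
  le_antisymm ((lead_hit_le hθ hb m j z).trans (h (m + 1) j hj).le) (lead_nonneg hθ hb _ _ _)

lemma Safe.miss (hθ : 0 < θ) (hb : ∀ u, 0 < b u) {k : ℕ} {z : ℕ × ℕ}
    (h : Safe θ b τ₁ τ₂ g (k + 1) z) : Safe θ b τ₁ τ₂ g k (miss z) := by
  intro m j hj
  have h1 := h (m + 1) (j + 1) (by omega)
  rw [lead_succ_succ] at h1
  have h2 := lead_nonneg (τ₁ := τ₁) (τ₂ := τ₂) (g := g) hθ hb m (j + 1) (InterDelivery.hit (g z) z)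
  have h3 := lead_nonneg (τ₁ := τ₁) (τ₂ := τ₂) (g := g) hθ hb m j (InterDelivery.miss z)
  have h4 := hb (g z)
  have h5 : b (g z) * lead θ b τ₁ τ₂ g m j (InterDelivery.miss z) = 0 := by
    nlinarith [mul_nonneg h4.le h3]
  simpa [h4.ne'] using h5

/-- Under any schedule, `k` failures in a row age both clients by `k`, and even then nobody may be
overdue. -/
lemma Safe.lt (hθ : 0 < θ) (hb : ∀ u, 0 < b u) {k : ℕ} {z : ℕ × ℕ}
    (h : Safe θ b τ₁ τ₂ g (k + 1) z) : z.1 + k < τ₁ ∧ z.2 + k < τ₂ := by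
  induction k generalizing z with
  | zero =>
    by_contra hz
    have := lead_zero_of_overdue (g := g) hθ hb (z := z) (τ₁ := τ₁) (τ₂ := τ₂) (by omega) one_pos
    rw [h 1 0 (by omega)] at this
    linarith [Real.add_one_lt_exp hθ.ne']
  | succ k ih =>
    have := ih (h.miss hθ hb)
    simp only [InterDelivery.miss] at this
    omega

lemma Safe.overdue_eq_zero (hθ : 0 < θ) (hb : ∀ u, 0 < b u) {k : ℕ} {z : ℕ × ℕ}
    (h : Safe θ b τ₁ τ₂ g (k + 1) z) : overdue τ₁ τ₂ z = 0 := by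
  have := h.lt hθ hb
  unfold overdue
  rw [if_neg (by omega), if_neg (by omega)]

end lead

/-! ### Expansion of the finite-horizon cost in ε -/

section asymptotics
variable {θ : ℝ} {b : Client → ℝ} {τ₁ τ₂ : ℕ} {g : ℕ × ℕ → Client}

lemma isBigO_id_pow {f : ℝ → ℝ} {k : ℕ} (hf : f =O[𝓝[>] 0] fun ε : ℝ => ε ^ k) :
    (fun ε => ε * f ε) =O[𝓝[>] 0] fun ε : ℝ => ε ^ (k + 1) := by
  simpa [pow_succ'] using (isBigO_refl (fun ε : ℝ => ε) (𝓝[>] 0)).mul hf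

lemma isBigO_one_of_continuous {f : ℝ → ℝ} (hf : Continuous f) :
    f =O[𝓝[>] 0] fun _ : ℝ => (1 : ℝ) :=
  ((hf.tendsto 0).mono_left nhdsWithin_le_nhds).isBigO_one ℝ

lemma isBigO_pow_of_le {k l : ℕ} (h : k ≤ l) :
    (fun ε : ℝ => ε ^ l) =O[𝓝[>] 0] fun ε : ℝ => ε ^ k := by
  obtain ⟨d, rfl⟩ := Nat.exists_eq_add_of_le h
  simpa [pow_add] using (isBigO_refl (fun ε : ℝ => ε ^ k) (𝓝[>] 0)).mul
    (isBigO_one_of_continuous (continuous_pow d))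

lemma isBigO_continuous_mul {f q : ℝ → ℝ} {k : ℕ} (hq : Continuous q)
    (hf : f =O[𝓝[>] 0] fun ε : ℝ => ε ^ k) :
    (fun ε => q ε * f ε) =O[𝓝[>] 0] fun ε : ℝ => ε ^ k := by
  simpa using (isBigO_one_of_continuous hq).mul hf

lemma continuous_value (m : ℕ) (z : ℕ × ℕ) : Continuous fun ε => value θ b τ₁ τ₂ g ε m z := by
  induction m generalizing z with
  | zero => simp only [value]; fun_prop
  | succ m ih =>
    simp only [value]
    have h1 := ih (hit (g z) z)
    have h2 := ih (miss z)
    fun_prop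

lemma eventually_rate_mul_lt_one (b : Client → ℝ) :
    ∀ᶠ ε : ℝ in 𝓝[>] 0, ∀ u, b u * ε < 1 := by
  have h (u) : ∀ᶠ ε : ℝ in 𝓝[>] 0, b u * ε < 1 := by
    have : Tendsto (fun ε : ℝ => b u * ε) (𝓝[>] 0) (𝓝 (b u * 0)) :=
      ((continuous_const.mul continuous_id).tendsto 0).mono_left nhdsWithin_le_nhds
    exact this.eventually_lt_const (by simp)
  filter_upwards [h .one, h .two] with ε h1 h2 u
  cases u <;> assumption

lemma one_le_value (hθ : 0 < θ) {ε : ℝ} (hε : 0 ≤ ε) (hb : ∀ u, 0 < b u) (h1 : ∀ u, b u * ε < 1)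
    (m : ℕ) (z : ℕ × ℕ) : 1 ≤ value θ b τ₁ τ₂ g ε m z := by
  induction m generalizing z with
  | zero => simp [value]
  | succ m ih =>
    rw [value]
    have e := one_le_exp_overdue (τ₁ := τ₁) (τ₂ := τ₂) hθ z
    have h2 := h1 (g z)
    have h3 := mul_nonneg (hb (g z)).le hε
    have : 1 ≤ (1 - b (g z) * ε) * value θ b τ₁ τ₂ g ε m (hit (g z) z)
        + b (g z) * ε * value θ b τ₁ τ₂ g ε m (miss z) := by
      nlinarith [ih (hit (g z) z), ih (miss z)]
    nlinarith

/-- The sample paths with `k` failures bound the cost from below. -/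
lemma exists_lead_le_value (hθ : 0 < θ) (hb : ∀ u, 0 < b u) (m k : ℕ) (z : ℕ × ℕ) :
    ∃ r : ℝ → ℝ, (r =O[𝓝[>] 0] fun ε : ℝ => ε ^ (k + 1)) ∧ ∀ᶠ ε : ℝ in 𝓝[>] 0,
      lead θ b τ₁ τ₂ g m k z * ε ^ k + r ε ≤ value θ b τ₁ τ₂ g ε m z - 1 := by
  induction m generalizing k z with
  | zero => exact ⟨0, isBigO_zero _ _, by simp [lead, value]⟩
  | succ m ih =>
    set B := b (g z)
    have hB : 0 < B := hb _
    set e := Real.exp (θ * overdue τ₁ τ₂ z) with he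
    have he1 : 1 ≤ e := one_le_exp_overdue hθ z
    cases k with
    | zero =>
      obtain ⟨r, hr, hle⟩ := ih 0 (hit (g z) z)
      set G := lead θ b τ₁ τ₂ g m 0 (hit (g z) z)
      refine ⟨fun ε => (e * (1 - B * ε)) * r ε + (-(e * B * G)) * ε, ?_, ?_⟩
      · exact (isBigO_continuous_mul (by fun_prop) hr).add
          (isBigO_continuous_mul (by fun_prop) (by simpa using isBigO_refl _ _))
      · filter_upwards [hle, self_mem_nhdsWithin, eventually_rate_mul_lt_one b] with ε h hε h1
        have hε0 : 0 < ε := hε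
        have hF := one_le_value (τ₁ := τ₁) (τ₂ := τ₂) (g := g) hθ hε0.le hb h1 m (miss z)
        have h2 : 0 < 1 - B * ε := by linarith [h1 (g z)]
        rw [value, lead_succ_zero]
        simp only [pow_zero, mul_one] at h ⊢
        have h3 : (1 - B * ε) * (G + r ε) ≤
            (1 - B * ε) * (value θ b τ₁ τ₂ g ε m (hit (g z) z) - 1) := by gcongr
        -- At order zero the failure branch is only used through being worth at least 1.
        have h4 : B * ε * 1 ≤ B * ε * value θ b τ₁ τ₂ g ε m (miss z) := by gcongr
        have h5 : e * ((1 - B * ε) * (1 + G + r ε) + B * ε) ≤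
            e * ((1 - B * ε) * value θ b τ₁ τ₂ g ε m (hit (g z) z)
              + B * ε * value θ b τ₁ τ₂ g ε m (miss z)) :=
          mul_le_mul_of_nonneg_left (by linarith) (by linarith)
        linarith
    | succ k =>
      obtain ⟨r, hr, hle⟩ := ih (k + 1) (hit (g z) z)
      obtain ⟨s, hs, hle'⟩ := ih k (miss z)
      set G := lead θ b τ₁ τ₂ g m (k + 1) (hit (g z) z) with hG
      set H := lead θ b τ₁ τ₂ g m k (miss z) with hH
      refine ⟨fun ε => (1 - B * ε) * r ε + (-(B * G)) * (ε ^ (k + 1 + 1)) + B * (ε * s ε),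
        ?_, ?_⟩
      · exact ((isBigO_continuous_mul (by fun_prop) hr).add
          (isBigO_continuous_mul (by fun_prop) (isBigO_refl _ _))).add
          (isBigO_continuous_mul (by fun_prop) (isBigO_id_pow hs))
      · filter_upwards [hle, hle', self_mem_nhdsWithin, eventually_rate_mul_lt_one b]
          with ε h h' hε h1
        have hε0 : 0 < ε := hε
        have h2 : 0 < 1 - B * ε := by linarith [h1 (g z)]
        have hF := one_le_value (τ₁ := τ₁) (τ₂ := τ₂) (g := g) hθ hε0.le hb h1 m (miss z)
        have hS := one_le_value (τ₁ := τ₁) (τ₂ := τ₂) (g := g) hθ hε0.le hb h1 m (hit (g z) z)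
        rw [value, lead_succ_succ]
        have h3 : (1 - B * ε) * (G * ε ^ (k + 1) + r ε) ≤
            (1 - B * ε) * (value θ b τ₁ τ₂ g ε m (hit (g z) z) - 1) := by gcongr
        have h4 : B * ε * (H * ε ^ k + s ε) ≤
            B * ε * (value θ b τ₁ τ₂ g ε m (miss z) - 1) := by gcongr
        have h5 : 0 ≤ (1 - B * ε) * value θ b τ₁ τ₂ g ε m (hit (g z) z)
            + B * ε * value θ b τ₁ τ₂ g ε m (miss z) := by positivity
        -- `lead` ignores violations before the last failure; as `e ≥ 1`, dropping that factor
        -- preserves a lower bound.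
        have h6 := mul_le_mul_of_nonneg_right he1 h5
        rw [one_mul] at h6
        have h7 : (G + B * H) * ε ^ (k + 1) + ((1 - B * ε) * r ε + (-(B * G)) * (ε ^ (k + 1 + 1))
            + B * (ε * s ε)) = (1 - B * ε) * (G * ε ^ (k + 1) + r ε)
            + B * ε * (H * ε ^ k + s ε) := by ring
        linarith

/-- If fewer than `k` failures are harmless, then `lead` is the exact leading coefficient. -/
lemma Safe.value_isBigO (hθ : 0 < θ) (hb : ∀ u, 0 < b u) {k : ℕ} {z : ℕ × ℕ}
    (h : Safe θ b τ₁ τ₂ g k z) (m : ℕ) :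
    (fun ε => value θ b τ₁ τ₂ g ε m z - 1 - lead θ b τ₁ τ₂ g m k z * ε ^ k)
      =O[𝓝[>] 0] fun ε : ℝ => ε ^ (k + 1) := by
  induction m generalizing k z with
  | zero => simpa [lead, value] using isBigO_zero _ _
  | succ m ih =>
    set B := b (g z)
    set e := Real.exp (θ * overdue τ₁ τ₂ z) with he
    cases k with
    | zero =>
      have h1 := ih (z := InterDelivery.hit (g z) z) (h.hit hθ hb)
      set G := lead θ b τ₁ τ₂ g m 0 (InterDelivery.hit (g z) z) with hG
      have h2 := (isBigO_continuous_mul (q := fun _ => e) (by fun_prop) h1).add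
        (isBigO_continuous_mul (k := 1) (f := fun ε => ε)
          (q := fun ε => e * B * (value θ b τ₁ τ₂ g ε m (InterDelivery.miss z)
            - value θ b τ₁ τ₂ g ε m (InterDelivery.hit (g z) z))) (by
            have := continuous_value (θ := θ) (b := b) (τ₁ := τ₁) (τ₂ := τ₂) (g := g) m
            have h3 := this (InterDelivery.miss z)
            have h4 := this (InterDelivery.hit (g z) z)
            fun_prop) (by simpa using isBigO_refl _ _))
      refine h2.congr_left fun ε => ?_
      rw [value, lead_succ_zero]
      ring
    | succ k =>
      have h1 := ih (h.hit hθ hb)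
      have h2 := ih (h.miss hθ hb)
      -- With a failure still to come, safety excludes a violation now, so the factor that `lead`
      -- ignores equals 1.
      have he0 : e = 1 := by rw [he, h.overdue_eq_zero hθ hb]; simp
      set G := lead θ b τ₁ τ₂ g m (k + 1) (InterDelivery.hit (g z) z) with hG
      set H := lead θ b τ₁ τ₂ g m k (InterDelivery.miss z) with hH
      have h3 := ((isBigO_continuous_mul (q := fun ε => 1 - B * ε) (by fun_prop) h1).add
          (isBigO_continuous_mul (q := fun _ => -(B * G)) (by fun_prop) (isBigO_refl _ _))).add
          (isBigO_continuous_mul (q := fun _ => B) (by fun_prop) (isBigO_id_pow h2))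
      refine h3.congr_left fun ε => ?_
      rw [value, lead_succ_succ, ← he, he0]
      ring

end asymptotics

/-! ### Identification of the path-sum cost with the recursion -/

/-- The system state with the given untruncated elapsed times. -/
def truncate (τ₁ τ₂ : ℕ) (z : ℕ × ℕ) : State τ₁ τ₂ :=
  (⟨min z.1 τ₁, Nat.lt_succ_of_le (min_le_right _ _)⟩,
    ⟨min z.2 τ₂, Nat.lt_succ_of_le (min_le_right _ _)⟩)

section horizon
variable {τ₁ τ₂ : ℕ}

lemma truncate_coe (x : State τ₁ τ₂) : truncate τ₁ τ₂ ((x.1 : ℕ), (x.2 : ℕ)) = x := by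
  have h1 := x.1.2
  have h2 := x.2.2
  ext <;> simp [truncate] <;> omega

lemma afterFailure_truncate (z : ℕ × ℕ) :
    afterFailure (truncate τ₁ τ₂ z) = truncate τ₁ τ₂ (miss z) := by
  ext <;> simp [truncate, afterFailure, miss, age] <;> omega

lemma afterSuccess_truncate (u : Client) (z : ℕ × ℕ) :
    afterSuccess u (truncate τ₁ τ₂ z) = truncate τ₁ τ₂ (hit u z) := by
  cases u <;> ext <;> simp [truncate, afterSuccess, hit, age] <;> omega

lemma violations_truncate (z : ℕ × ℕ) :
    violations (truncate τ₁ τ₂ z) = overdue τ₁ τ₂ z := by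
  simp [violations, truncate, overdue]

lemma horizonCost_zero (θ : ℝ) (p : Client → ℝ) (f : Policy τ₁ τ₂) (x : State τ₁ τ₂) :
    horizonCost θ p f 0 x = 1 := by
  simp only [horizonCost, pathProb, Finset.univ_eq_empty, Finset.prod_empty, Finset.sum_empty,
    mul_zero, Real.exp_zero, mul_one]
  rw [Fintype.sum_eq_single (fun _ => x)]
  · simp
  · intro y hy
    rw [if_neg]
    rintro rfl
    exact hy (funext fun i => congrArg y (Fin.fin_one_eq_zero i))

lemma sum_transProb_mul (p : Client → ℝ) (u : Client) (x : State τ₁ τ₂) (h : State τ₁ τ₂ → ℝ) :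
    ∑ y, transProb p u x y * h y = p u * h (afterSuccess u x) + (1 - p u) * h (afterFailure x) := by
  simp [transProb, add_mul, Finset.sum_add_distrib, ite_mul]

lemma pathProb_cons (p : Client → ℝ) (f : Policy τ₁ τ₂) (T : ℕ) (x y₀ : State τ₁ τ₂)
    (y : Fin (T + 1) → State τ₁ τ₂) :
    pathProb p f (T + 1) x (Fin.cons y₀ y : Fin (T + 1 + 1) → State τ₁ τ₂) =
      if y₀ = x then transProb p (f x) x (y 0) * pathProb p f T (y 0) y else 0 := by
  unfold pathProb
  simp only [Fin.cons_zero, if_true]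
  split_ifs with h
  · subst h
    rw [Fin.prod_univ_succ]
    simp [Fin.castSucc_zero, Fin.cons_succ]
  · rfl

lemma horizonCost_succ (θ : ℝ) (p : Client → ℝ) (f : Policy τ₁ τ₂) (T : ℕ) (x : State τ₁ τ₂) :
    horizonCost θ p f (T + 1) x = Real.exp (θ * violations x) *
      (p (f x) * horizonCost θ p f T (afterSuccess (f x) x)
        + (1 - p (f x)) * horizonCost θ p f T (afterFailure x)) := by
  rw [← sum_transProb_mul p (f x) x (horizonCost θ p f T)]
  have e1 : horizonCost θ p f (T + 1) x = ∑ q : State τ₁ τ₂ × (Fin (T + 1) → State τ₁ τ₂),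
      pathProb p f (T + 1) x (Fin.cons q.1 q.2 : Fin (T + 1 + 1) → State τ₁ τ₂) *
        Real.exp (θ * ∑ t : Fin (T + 1), (violations
          ((Fin.cons q.1 q.2 : Fin (T + 1 + 1) → State τ₁ τ₂) t.castSucc) : ℝ)) :=
    (Equiv.sum_comp (Fin.consEquiv fun _ : Fin (T + 1 + 1) => State τ₁ τ₂) _).symm
  rw [e1, Fintype.sum_prod_type, Fintype.sum_eq_single x]
  · have e2 (y : Fin (T + 1) → State τ₁ τ₂) :
        pathProb p f (T + 1) x (Fin.cons x y : Fin (T + 1 + 1) → State τ₁ τ₂) *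
        Real.exp (θ * ∑ t : Fin (T + 1), (violations
          ((Fin.cons x y : Fin (T + 1 + 1) → State τ₁ τ₂) t.castSucc) : ℝ)) =
        ∑ w, Real.exp (θ * violations x) * (transProb p (f x) x w * (pathProb p f T w y *
          Real.exp (θ * ∑ t : Fin T, (violations (y t.castSucc) : ℝ)))) := by
      rw [Fintype.sum_eq_single (y 0)]
      · rw [pathProb_cons, if_pos rfl, Fin.sum_univ_succ]
        simp only [Fin.castSucc_zero, Fin.cons_zero, ← Fin.succ_castSucc, Fin.cons_succ]
        rw [mul_add, Real.exp_add]
        ring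
      · intro w hw
        simp [pathProb, hw.symm]
    simp only [e2]
    rw [Finset.sum_comm, Finset.mul_sum]
    refine Finset.sum_congr rfl fun w _ => ?_
    rw [horizonCost, Finset.mul_sum, Finset.mul_sum]
  · intro y hy
    refine Finset.sum_eq_zero fun w _ => ?_
    rw [pathProb_cons, if_neg hy, zero_mul]

lemma reliability_eq (b₁ b₂ ε : ℝ) (u : Client) :
    reliability b₁ b₂ ε u = 1 - rate b₁ b₂ u * ε := by
  cases u <;> rfl

lemma horizonCost_truncate (θ b₁ b₂ ε : ℝ) (f : Policy τ₁ τ₂) (T : ℕ) (z : ℕ × ℕ) :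
    horizonCost θ (reliability b₁ b₂ ε) f T (truncate τ₁ τ₂ z) =
      value θ (rate b₁ b₂) τ₁ τ₂ (fun w => f (truncate τ₁ τ₂ w)) ε T z := by
  induction T generalizing z with
  | zero => rw [horizonCost_zero, value]
  | succ T ih =>
    rw [horizonCost_succ, value, violations_truncate, afterSuccess_truncate,
      afterFailure_truncate, ih, ih, reliability_eq]
    ring

lemma horizonCost_eq_value (θ b₁ b₂ ε : ℝ) (f : Policy τ₁ τ₂) (T : ℕ) (x : State τ₁ τ₂) :
    horizonCost θ (reliability b₁ b₂ ε) f T x =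
      value θ (rate b₁ b₂) τ₁ τ₂ (fun w => f (truncate τ₁ τ₂ w)) ε T ((x.1 : ℕ), (x.2 : ℕ)) := by
  rw [← horizonCost_truncate, truncate_coe]

end horizon

/-! ### From growth over one period to the average cost -/

section growth

lemma exists_forall_le_of_add_le {l : ℕ → ℝ} {N L : ℕ} (hL : 0 < L)
    (h : ∀ T, N ≤ T → l (T + L) ≤ l T) : ∃ C, ∀ T, N ≤ T → l T ≤ C := by
  obtain ⟨C, hC⟩ := ((Finset.range (N + L)).image l).exists_le
  refine ⟨C, fun T => ?_⟩
  induction T using Nat.strong_induction_on with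
  | _ T ih =>
    intro hT
    by_cases hTL : T < N + L
    · exact hC _ (Finset.mem_image_of_mem _ (Finset.mem_range.2 hTL))
    · have h1 := h (T - L) (by omega)
      rw [Nat.sub_add_cancel (by omega)] at h1
      exact h1.trans (ih (T - L) (by omega) (by omega))

lemma tendsto_growth (θ C r : ℝ) :
    Tendsto (fun T : ℕ => 1 / θ * (1 / (T : ℝ)) * (C + T * r)) atTop (𝓝 (r / θ)) := by
  have h1 : Tendsto (fun T : ℕ => C / (T : ℝ)) atTop (𝓝 0) :=
    tendsto_const_div_atTop_nhds_zero_nat C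
  have h2 : Tendsto (fun T : ℕ => 1 / θ * (C / (T : ℝ) + r)) atTop (𝓝 (1 / θ * (0 + r))) :=
    (h1.add tendsto_const_nhds).const_mul _
  rw [show r / θ = 1 / θ * (0 + r) by ring]
  refine h2.congr' ?_
  filter_upwards [eventually_gt_atTop 0] with T hT
  have : (T : ℝ) ≠ 0 := by positivity
  field_simp

/-- After subtracting the line of slope `log lam / L`, the logarithm does not increase in steps of
`L`, hence stays bounded above; a bounded term disappears on division by `T`. -/
lemma limsup_log_le {a : ℕ → ℝ} {θ lam : ℝ} {N L : ℕ} (hθ : 0 < θ) (hL : 0 < L) (hlam : 0 < lam)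
    (ha : ∀ T, 1 ≤ a T) (h : ∀ T, N ≤ T → a (T + L) ≤ lam * a T) :
    limsup (fun T : ℕ => 1 / θ * (1 / (T : ℝ)) * Real.log (a T)) atTop
      ≤ Real.log lam / L / θ := by
  have hL' : (L : ℝ) ≠ 0 := by positivity
  obtain ⟨C, hC⟩ := exists_forall_le_of_add_le
    (l := fun T => Real.log (a T) - T * (Real.log lam / L)) hL (N := N) (by
      intro T hT
      have h1 := Real.log_le_log (by linarith [ha (T + L)]) (h T hT)
      rw [Real.log_mul hlam.ne' (by linarith [ha T])] at h1
      have : ((T + L : ℕ) : ℝ) * (Real.log lam / L) = T * (Real.log lam / L) + Real.log lam := by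
        push_cast; field_simp
      simp only [this]
      linarith)
  have ht := tendsto_growth θ C (Real.log lam / L)
  rw [← ht.limsup_eq]
  refine limsup_le_limsup ?_ ?_ ht.isBoundedUnder_le
  · filter_upwards [eventually_ge_atTop N] with T hT
    gcongr
    linarith [hC T hT]
  · refine IsBoundedUnder.isCoboundedUnder_le ⟨0, ?_⟩
    refine eventually_map.2 (Eventually.of_forall fun T => ?_)
    have := Real.log_nonneg (ha T)
    positivity

/-- The mirror image of `limsup_log_le`. The linear bound `hR` makes the real-valued `limsup`
meaningful: it supplies the boundedness needed to compare the two limits. -/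
lemma le_limsup_log {a : ℕ → ℝ} {θ lam R : ℝ} {N L : ℕ} (hθ : 0 < θ) (hL : 0 < L)
    (hlam : 0 < lam) (ha : ∀ T, 1 ≤ a T) (hR : ∀ T : ℕ, Real.log (a T) ≤ T * R)
    (h : ∀ T, N ≤ T → lam * a T ≤ a (T + L)) :
    Real.log lam / L / θ
      ≤ limsup (fun T : ℕ => 1 / θ * (1 / (T : ℝ)) * Real.log (a T)) atTop := by
  have hL' : (L : ℝ) ≠ 0 := by positivity
  obtain ⟨C, hC⟩ := exists_forall_le_of_add_le
    (l := fun T => T * (Real.log lam / L) - Real.log (a T)) hL (N := N) (by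
      intro T hT
      have h1 := Real.log_le_log (mul_pos hlam (by linarith [ha T])) (h T hT)
      rw [Real.log_mul hlam.ne' (by linarith [ha T])] at h1
      have : ((T + L : ℕ) : ℝ) * (Real.log lam / L) = T * (Real.log lam / L) + Real.log lam := by
        push_cast; field_simp
      simp only [this]
      linarith)
  have ht := tendsto_growth θ (-C) (Real.log lam / L)
  rw [← ht.limsup_eq]
  refine limsup_le_limsup ?_ ht.isCoboundedUnder_le ?_
  · filter_upwards [eventually_ge_atTop N] with T hT
    gcongr
    linarith [hC T hT]
  · refine (tendsto_growth θ 0 R).isBoundedUnder_le.mono_le (Eventually.of_forall fun T => ?_)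
    change 1 / θ * (1 / (T : ℝ)) * Real.log (a T) ≤ 1 / θ * (1 / (T : ℝ)) * (0 + T * R)
    gcongr
    linarith [hR T]

variable {τ₁ τ₂ : ℕ}

lemma one_le_horizonCost {θ : ℝ} {p : Client → ℝ} (hθ : 0 < θ) (hp : ∀ u, 0 ≤ p u)
    (hp1 : ∀ u, p u ≤ 1) (f : Policy τ₁ τ₂) (T : ℕ) (x : State τ₁ τ₂) :
    1 ≤ horizonCost θ p f T x := by
  induction T generalizing x with
  | zero => rw [horizonCost_zero]
  | succ T ih =>
    rw [horizonCost_succ]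
    have e : 1 ≤ Real.exp (θ * violations x) := Real.one_le_exp (by positivity)
    have : 1 ≤ p (f x) * horizonCost θ p f T (afterSuccess (f x) x)
        + (1 - p (f x)) * horizonCost θ p f T (afterFailure x) := by
      nlinarith [ih (afterSuccess (f x) x), ih (afterFailure x), hp (f x), hp1 (f x)]
    nlinarith

lemma horizonCost_le {θ : ℝ} {p : Client → ℝ} (hθ : 0 < θ) (hp : ∀ u, 0 ≤ p u)
    (hp1 : ∀ u, p u ≤ 1) (f : Policy τ₁ τ₂) (T : ℕ) (x : State τ₁ τ₂) :
    horizonCost θ p f T x ≤ Real.exp (T * (2 * θ)) := by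
  induction T generalizing x with
  | zero => simp [horizonCost_zero]
  | succ T ih =>
    rw [horizonCost_succ]
    have e : Real.exp (θ * violations x) ≤ Real.exp (2 * θ) := by
      apply Real.exp_le_exp.2
      have : (violations x : ℝ) ≤ 2 := by
        have : violations x ≤ 2 := by unfold violations; split_ifs <;> simp
        exact_mod_cast this
      nlinarith
    have h1 : p (f x) * horizonCost θ p f T (afterSuccess (f x) x)
        + (1 - p (f x)) * horizonCost θ p f T (afterFailure x) ≤ Real.exp (T * (2 * θ)) := by
      nlinarith [ih (afterSuccess (f x) x), ih (afterFailure x), hp (f x), hp1 (f x)]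
    have e2 : Real.exp ((T + 1 : ℕ) * (2 * θ)) =
        Real.exp (2 * θ) * Real.exp (T * (2 * θ)) := by
      rw [← Real.exp_add]; push_cast; ring_nf
    rw [e2]
    exact (mul_le_mul_of_nonneg_left h1 (Real.exp_pos _).le).trans
      (mul_le_mul_of_nonneg_right e (Real.exp_pos _).le)

/-- The first-step recursion is linear with nonnegative coefficients, so an inequality valid at all
states for horizon `N` passes to longer horizons. -/
lemma horizonCost_le_of_le {θ lam : ℝ} {p : Client → ℝ} (hp : ∀ u, 0 ≤ p u)
    (hp1 : ∀ u, p u ≤ 1) (f : Policy τ₁ τ₂) {N L : ℕ}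
    (h : ∀ y, horizonCost θ p f (N + L) y ≤ lam * horizonCost θ p f N y) {T : ℕ} (hT : N ≤ T)
    (x : State τ₁ τ₂) : horizonCost θ p f (T + L) x ≤ lam * horizonCost θ p f T x := by
  induction T, hT using Nat.le_induction generalizing x with
  | base => exact h x
  | succ T _ ih =>
    rw [Nat.add_right_comm, horizonCost_succ, horizonCost_succ, mul_left_comm]
    refine mul_le_mul_of_nonneg_left ?_ (Real.exp_pos _).le
    nlinarith [mul_le_mul_of_nonneg_left (ih (afterSuccess (f x) x)) (hp (f x)),
      mul_le_mul_of_nonneg_left (ih (afterFailure x)) (sub_nonneg.2 (hp1 (f x)))]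

lemma le_horizonCost_of_le {θ lam : ℝ} {p : Client → ℝ} (hp : ∀ u, 0 ≤ p u)
    (hp1 : ∀ u, p u ≤ 1) (f : Policy τ₁ τ₂) {N L : ℕ}
    (h : ∀ y, lam * horizonCost θ p f N y ≤ horizonCost θ p f (N + L) y) {T : ℕ} (hT : N ≤ T)
    (x : State τ₁ τ₂) : lam * horizonCost θ p f T x ≤ horizonCost θ p f (T + L) x := by
  induction T, hT using Nat.le_induction generalizing x with
  | base => exact h x
  | succ T _ ih =>
    rw [Nat.add_right_comm, horizonCost_succ, horizonCost_succ, mul_left_comm]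
    refine mul_le_mul_of_nonneg_left ?_ (Real.exp_pos _).le
    nlinarith [mul_le_mul_of_nonneg_left (ih (afterSuccess (f x) x)) (hp (f x)),
      mul_le_mul_of_nonneg_left (ih (afterFailure x)) (sub_nonneg.2 (hp1 (f x)))]

/-- A uniform one-period upper bound on the growth of the cost bounds the average cost. -/
lemma avgCost_le {θ lam : ℝ} {p : Client → ℝ} (hθ : 0 < θ) (hp : ∀ u, 0 ≤ p u)
    (hp1 : ∀ u, p u ≤ 1) (f : Policy τ₁ τ₂) {N L : ℕ} (hL : 0 < L) (hlam : 0 < lam)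
    (h : ∀ y, horizonCost θ p f (N + L) y ≤ lam * horizonCost θ p f N y) (x : State τ₁ τ₂) :
    avgCost θ p f x ≤ Real.log lam / L / θ :=
  limsup_log_le hθ hL hlam (fun T => one_le_horizonCost hθ hp hp1 f T x)
    fun _ hT => horizonCost_le_of_le hp hp1 f h hT x

/-- A uniform one-period lower bound on the growth of the cost bounds the average cost. -/
lemma le_avgCost {θ lam : ℝ} {p : Client → ℝ} (hθ : 0 < θ) (hp : ∀ u, 0 ≤ p u)
    (hp1 : ∀ u, p u ≤ 1) (f : Policy τ₁ τ₂) {N L : ℕ} (hL : 0 < L) (hlam : 0 < lam)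
    (h : ∀ y, lam * horizonCost θ p f N y ≤ horizonCost θ p f (N + L) y) (x : State τ₁ τ₂) :
    Real.log lam / L / θ ≤ avgCost θ p f x :=
  le_limsup_log (R := 2 * θ) hθ hL hlam (fun T => one_le_horizonCost hθ hp hp1 f T x)
    (fun T => by
      have h1 := one_le_horizonCost hθ hp hp1 f T x
      have := Real.log_le_log (by linarith) (horizonCost_le hθ hp hp1 f T x)
      rwa [Real.log_exp] at this)
    fun _ hT => le_horizonCost_of_le hp hp1 f h hT x

end growth

/-! ### Complete homogeneous polynomials in two variables -/

/-- The complete homogeneous symmetric polynomial of degree `k` in two variables. -/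
def homSum (b₁ b₂ : ℝ) (k : ℕ) : ℝ := ∑ j ∈ Finset.range (k + 1), b₁ ^ j * b₂ ^ (k - j)

lemma homSum_zero (b₁ b₂ : ℝ) : homSum b₁ b₂ 0 = 1 := by simp [homSum]

lemma homSum_comm (b₁ b₂ : ℝ) (k : ℕ) : homSum b₁ b₂ k = homSum b₂ b₁ k := by
  unfold homSum
  rw [← Finset.sum_range_reflect]
  refine Finset.sum_congr rfl fun j hj => ?_
  have := Finset.mem_range.1 hj
  rw [show k + 1 - 1 - j = k - j by omega, show k - (k - j) = j by omega, mul_comm]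

/-- This and `homSum_succ'` describe serving client 1 and client 2 in a tied state; that both
produce the same polynomial makes the weight there independent of the choice. -/
lemma homSum_succ (b₁ b₂ : ℝ) (k : ℕ) :
    homSum b₁ b₂ (k + 1) = b₂ ^ (k + 1) + b₁ * homSum b₁ b₂ k := by
  unfold homSum
  rw [Finset.sum_range_succ', Finset.mul_sum, add_comm]
  congr 1
  · simp
  · refine Finset.sum_congr rfl fun j _ => ?_
    rw [show k + 1 - (j + 1) = k - j by omega]
    ring

lemma homSum_succ' (b₁ b₂ : ℝ) (k : ℕ) :
    homSum b₁ b₂ (k + 1) = b₁ ^ (k + 1) + b₂ * homSum b₁ b₂ k := by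
  rw [homSum_comm, homSum_succ, homSum_comm]

lemma homSum_pos {b₁ b₂ : ℝ} (hb₁ : 0 < b₁) (hb₂ : 0 < b₂) (k : ℕ) : 0 < homSum b₁ b₂ k :=
  Finset.sum_pos (fun _ _ => by positivity) (by simp)

/-! ### Lower bounds for critical weights under safe policies -/

section lower
variable {θ b₁ b₂ : ℝ} {τ₁ τ₂ : ℕ} {g : ℕ × ℕ → Client}

local notation "G" => lead θ (rate b₁ b₂) τ₁ τ₂ g
local notation "SafeFor" => Safe θ (rate b₁ b₂) τ₁ τ₂ g

lemma hit_cases (u : Client) (z : ℕ × ℕ) :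
    (u = .one ∧ hit u z = (0, z.2 + 1)) ∨ (u = .two ∧ hit u z = (z.1 + 1, 0)) := by
  cases u <;> simp [hit]

/-- Client 1 must be served when it cannot afford another slot. -/
lemma Safe.eq_one (hθ : 0 < θ) (hb₁ : 0 < b₁) (hb₂ : 0 < b₂) {k : ℕ} {z : ℕ × ℕ}
    (h : SafeFor (k + 1) z) (hz : z.1 + (k + 1) = τ₁) : g z = .one := by
  rcases hit_cases (g z) z with h1 | h1
  · exact h1.1
  · have := (h.hit hθ (rate_pos hb₁ hb₂)).lt hθ (rate_pos hb₁ hb₂)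
    rw [h1.2] at this
    simp only at this
    omega

/-- Client 2 must be served when it cannot afford another slot. -/
lemma Safe.eq_two (hθ : 0 < θ) (hb₁ : 0 < b₁) (hb₂ : 0 < b₂) {k : ℕ} {z : ℕ × ℕ}
    (h : SafeFor (k + 1) z) (hz : z.2 + (k + 1) = τ₂) : g z = .two := by
  rcases hit_cases (g z) z with h1 | h1
  · have := (h.hit hθ (rate_pos hb₁ hb₂)).lt hθ (rate_pos hb₁ hb₂)
    rw [h1.2] at this
    simp only at this
    omega
  · exact h1.1

/-- Client 1 has no spare slot, so it is served in every one of `k` consecutive failures, each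
contributing a factor `b₁`. -/
lemma Safe.pow_le_lead_one (hθ : 0 < θ) (hb₁ : 0 < b₁) (hb₂ : 0 < b₂) {k m : ℕ} {z : ℕ × ℕ}
    (h : SafeFor k z) (hz : z.1 + k = τ₁) (hm : k < m) :
    b₁ ^ k * (Real.exp θ - 1) ≤ G m k z := by
  have hb := rate_pos hb₁ hb₂
  induction k generalizing m z with
  | zero => simpa using lead_zero_of_overdue hθ hb (.inl (by omega)) hm
  | succ k ih =>
    obtain ⟨m, rfl⟩ := Nat.exists_eq_succ_of_ne_zero (by omega : m ≠ 0)
    have h1 := h.eq_one hθ hb₁ hb₂ hz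
    have h2 := ih (m := m) (h.miss hθ hb) (by simp only [InterDelivery.miss]; omega) (by omega)
    have h3 := lead_nonneg (τ₁ := τ₁) (τ₂ := τ₂) (g := g) hθ hb m (k + 1)
      (InterDelivery.hit (g z) z)
    rw [lead_succ_succ]
    have h4 : rate b₁ b₂ (g z) = b₁ := by rw [h1]; rfl
    rw [h4, pow_succ', mul_assoc]
    linarith [mul_le_mul_of_nonneg_left h2 hb₁.le]

lemma Safe.pow_le_lead_two (hθ : 0 < θ) (hb₁ : 0 < b₁) (hb₂ : 0 < b₂) {k m : ℕ} {z : ℕ × ℕ}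
    (h : SafeFor k z) (hz : z.2 + k = τ₂) (hm : k < m) :
    b₂ ^ k * (Real.exp θ - 1) ≤ G m k z := by
  have hb := rate_pos hb₁ hb₂
  induction k generalizing m z with
  | zero => simpa using lead_zero_of_overdue hθ hb (.inr (by omega)) hm
  | succ k ih =>
    obtain ⟨m, rfl⟩ := Nat.exists_eq_succ_of_ne_zero (by omega : m ≠ 0)
    have h1 := h.eq_two hθ hb₁ hb₂ hz
    have h2 := ih (m := m) (h.miss hθ hb) (by simp only [InterDelivery.miss]; omega) (by omega)
    have h3 := lead_nonneg (τ₁ := τ₁) (τ₂ := τ₂) (g := g) hθ hb m (k + 1)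
      (InterDelivery.hit (g z) z)
    rw [lead_succ_succ]
    have h4 : rate b₁ b₂ (g z) = b₂ := by rw [h1]; rfl
    rw [h4, pow_succ', mul_assoc]
    linarith [mul_le_mul_of_nonneg_left h2 hb₂.le]

/-- Both clients have one spare slot: whichever is served first, `k` failures are critical. -/
lemma Safe.homSum_le_lead (hθ : 0 < θ) (hb₁ : 0 < b₁) (hb₂ : 0 < b₂) {k m : ℕ} {z : ℕ × ℕ}
    (h : SafeFor k z) (hz₁ : z.1 + k + 1 = τ₁) (hz₂ : z.2 + k + 1 = τ₂) (hm : k + 1 < m) :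
    homSum b₁ b₂ k * (Real.exp θ - 1) ≤ G m k z := by
  have hb := rate_pos hb₁ hb₂
  induction k generalizing m z with
  | zero =>
    obtain ⟨m, rfl⟩ := Nat.exists_eq_succ_of_ne_zero (by omega : m ≠ 0)
    refine le_trans ?_ (lead_hit_le hθ hb m 0 z)
    rw [homSum_zero, one_mul]
    refine lead_zero_of_overdue hθ hb ?_ (by omega)
    rcases hit_cases (g z) z with h1 | h1 <;> rw [h1.2] <;> simp only <;> omega
  | succ k ih =>
    obtain ⟨m, rfl⟩ := Nat.exists_eq_succ_of_ne_zero (by omega : m ≠ 0)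
    have h2 := ih (m := m) (h.miss hθ hb) (by simp only [InterDelivery.miss]; omega)
      (by simp only [InterDelivery.miss]; omega) (by omega)
    have hs := h.hit hθ hb
    rw [lead_succ_succ]
    -- A failure preserves the tie; a success leaves the other client without a spare slot,
    -- contributing a pure power of its rate.
    rcases hit_cases (g z) z with h1 | h1
    · have h3 := hs.pow_le_lead_two (m := m) hθ hb₁ hb₂ (by rw [h1.2]; simp only; omega) (by omega)
      have h4 : rate b₁ b₂ (g z) = b₁ := by rw [h1.1]; rfl
      rw [h4, homSum_succ]
      linarith [mul_le_mul_of_nonneg_left h2 hb₁.le]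
    · have h3 := hs.pow_le_lead_one (m := m) hθ hb₁ hb₂ (by rw [h1.2]; simp only; omega) (by omega)
      have h4 : rate b₁ b₂ (g z) = b₂ := by rw [h1.1]; rfl
      rw [h4, homSum_succ']
      linarith [mul_le_mul_of_nonneg_left h2 hb₂.le]

/-- One client is overdue now, and whichever client is not served is overdue in the next slot: two
violations, with e^(2θ) - 1 = (1 + e^θ)(e^θ - 1). -/
lemma sq_le_lead_zero (hθ : 0 < θ) (hb₁ : 0 < b₁) (hb₂ : 0 < b₂) {m : ℕ} {z : ℕ × ℕ}
    (hz : τ₁ ≤ z.1 ∨ τ₂ ≤ z.2) (hz₁ : τ₁ ≤ z.1 + 1) (hz₂ : τ₂ ≤ z.2 + 1) (hm : 1 < m) :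
    (1 + Real.exp θ) * (Real.exp θ - 1) ≤ G m 0 z := by
  have hb := rate_pos hb₁ hb₂
  obtain ⟨m, rfl⟩ := Nat.exists_eq_succ_of_ne_zero (by omega : m ≠ 0)
  rw [lead_succ_zero]
  have h1 : Real.exp θ - 1 ≤ G m 0 (hit (g z) z) := by
    refine lead_zero_of_overdue hθ hb ?_ (by omega)
    rcases hit_cases (g z) z with h1 | h1 <;> rw [h1.2] <;> simp only <;> omega
  have h2 := exp_le_exp_overdue hθ hz
  nlinarith [Real.exp_pos θ]

/-- Client 2 is forced. A success at some point leaves client 1 on its critical line, while a run of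
failures only ends in the double violation of `sq_le_lead_zero`; this produces the extra e^θ term.
-/
lemma Safe.double_le_lead_two (hθ : 0 < θ) (hb₁ : 0 < b₁) (hb₂ : 0 < b₂) {k m : ℕ} {z : ℕ × ℕ}
    (h : SafeFor k z) (hz₁ : z.1 + k + 1 = τ₁) (hz₂ : z.2 + k = τ₂) (hm : k + 1 < m) :
    (homSum b₁ b₂ k + Real.exp θ * b₂ ^ k) * (Real.exp θ - 1) ≤ G m k z := by
  have hb := rate_pos hb₁ hb₂
  induction k generalizing m z with
  | zero =>
    rw [homSum_zero, pow_zero, mul_one]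
    exact sq_le_lead_zero hθ hb₁ hb₂ (.inr (by omega)) (by omega) (by omega) (by omega)
  | succ k ih =>
    obtain ⟨m, rfl⟩ := Nat.exists_eq_succ_of_ne_zero (by omega : m ≠ 0)
    have h2 := ih (m := m) (h.miss hθ hb) (by simp only [InterDelivery.miss]; omega)
      (by simp only [InterDelivery.miss]; omega) (by omega)
    have hs := h.hit hθ hb
    have h1 := h.eq_two hθ hb₁ hb₂ hz₂
    rw [lead_succ_succ]
    have h3 := hs.pow_le_lead_one (m := m) hθ hb₁ hb₂
      (by rw [h1]; simp only [InterDelivery.hit]; omega) (by omega)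
    have h4 : rate b₁ b₂ (g z) = b₂ := by rw [h1]; rfl
    rw [h4, homSum_succ']
    have h5 := mul_le_mul_of_nonneg_left h2 hb₂.le
    rw [pow_succ' b₂]
    linarith

lemma Safe.double_le_lead_one (hθ : 0 < θ) (hb₁ : 0 < b₁) (hb₂ : 0 < b₂) {k m : ℕ} {z : ℕ × ℕ}
    (h : SafeFor k z) (hz₁ : z.1 + k = τ₁) (hz₂ : z.2 + k + 1 = τ₂) (hm : k + 1 < m) :
    (homSum b₁ b₂ k + Real.exp θ * b₁ ^ k) * (Real.exp θ - 1) ≤ G m k z := by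
  have hb := rate_pos hb₁ hb₂
  induction k generalizing m z with
  | zero =>
    rw [homSum_zero, pow_zero, mul_one]
    exact sq_le_lead_zero hθ hb₁ hb₂ (.inl (by omega)) (by omega) (by omega) (by omega)
  | succ k ih =>
    obtain ⟨m, rfl⟩ := Nat.exists_eq_succ_of_ne_zero (by omega : m ≠ 0)
    have h2 := ih (m := m) (h.miss hθ hb) (by simp only [InterDelivery.miss]; omega)
      (by simp only [InterDelivery.miss]; omega) (by omega)
    have hs := h.hit hθ hb
    have h1 := h.eq_one hθ hb₁ hb₂ hz₁
    rw [lead_succ_succ]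
    have h3 := hs.pow_le_lead_two (m := m) hθ hb₁ hb₂
      (by rw [h1]; simp only [InterDelivery.hit]; omega) (by omega)
    have h4 : rate b₁ b₂ (g z) = b₁ := by rw [h1]; rfl
    rw [h4, homSum_succ]
    have h5 := mul_le_mul_of_nonneg_left h2 hb₁.le
    rw [pow_succ' b₁]
    linarith

end lower

/-! ### Cycles of safe policies -/

/-- `β` is at most the mean critical weight per slot of every cycle that a safe policy can follow,
for the thresholds `q + 2` and `q + 2 + Δ`. -/
structure IsCycleRate (θ b₁ b₂ : ℝ) (q Δ : ℕ) (β : ℝ) : Prop where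
  nonneg : 0 ≤ β
  -- The cycle (1,0), (0,1), …, (0,k) has length k + 1. Here k = 1; the next three bounds treat k <
  -- Δ, k = Δ and k = Δ + 1 for positive Δ.
  equal : Δ = 0 → 2 * β ≤ (b₁ * (homSum b₁ b₂ q + Real.exp θ * b₁ ^ q)
    + b₂ * (homSum b₁ b₂ q + Real.exp θ * b₂ ^ q)) * (Real.exp θ - 1)
  short : 2 ≤ Δ → Δ * β ≤ b₁ ^ (q + 1) * (Real.exp θ - 1)
  diag : 1 ≤ Δ → (Δ + 1) * β ≤ (b₁ ^ (q + 1) + b₂ * homSum b₁ b₂ q) * (Real.exp θ - 1)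
  long : 1 ≤ Δ → (Δ + 2) * β ≤ (b₁ ^ (q + 1) + b₁ * homSum b₁ b₂ q
    + b₂ * (homSum b₁ b₂ q + Real.exp θ * b₂ ^ q)) * (Real.exp θ - 1)

section cycle
variable {θ b₁ b₂ : ℝ} {q Δ : ℕ} {g : ℕ × ℕ → Client}

local notation "G" => lead θ (rate b₁ b₂) (q + 2) (q + 2 + Δ) g
local notation "SafeFor" => Safe θ (rate b₁ b₂) (q + 2) (q + 2 + Δ) g

/-- From `(0, j)` a safe policy serves client 1 until some state `(0, k)`, where it serves
client 2. -/
lemma Safe.exists_two (hθ : 0 < θ) (hb₁ : 0 < b₁) (hb₂ : 0 < b₂) {j : ℕ}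
    (h : SafeFor (q + 1) (0, j)) : ∃ k, j ≤ k ∧ k ≤ Δ + 1 ∧ g (0, k) = .two ∧
      (∀ i, j ≤ i → i < k → g (0, i) = .one) ∧ ∀ i, j ≤ i → i ≤ k → SafeFor (q + 1) (0, i) := by
  have hb := rate_pos hb₁ hb₂
  have hj := (h.lt hθ hb).2
  simp only at hj
  obtain ⟨d, hd⟩ : ∃ d, j + d = Δ + 1 := ⟨Δ + 1 - j, by omega⟩
  induction d generalizing j with
  | zero =>
    refine ⟨j, le_rfl, by omega, ?_, fun i h1 h2 => by omega, fun i h1 h2 => ?_⟩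
    -- In `(0, Δ + 1)` client 2 is exactly `q + 1` slots from its threshold, so it is forced.
    · exact h.eq_two hθ hb₁ hb₂ (by simp only; omega)
    · rwa [show i = j by omega]
  | succ d ih =>
    rcases hit_cases (g (0, j)) (0, j) with h1 | h1
    · have hs := h.hit hθ hb
      rw [h1.2] at hs
      obtain ⟨k, k1, k2, k3, k4, k5⟩ := ih hs (by simp only at hj ⊢; omega)
        (by simp only at hj ⊢; omega)
      simp only at k1 k4 k5
      refine ⟨k, by omega, k2, k3, fun i i1 i2 => ?_, fun i i1 i2 => ?_⟩
      · rcases Nat.lt_or_ge j i with i3 | i3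
        · exact k4 i (by omega) i2
        · rw [show i = j by omega]; exact h1.1
      · rcases Nat.lt_or_ge j i with i3 | i3
        · exact k5 i (by omega) i2
        · rwa [show i = j by omega]
    · refine ⟨j, le_rfl, by omega, h1.1, fun i h1 h2 => by omega, fun i h1 h2 => ?_⟩
      rwa [show i = j by omega]

lemma lead_le_of_one (hθ : 0 < θ) (hb₁ : 0 < b₁) (hb₂ : 0 < b₂) {j d : ℕ}
    (h : ∀ i, j ≤ i → i < j + d → g (0, i) = .one) (m k : ℕ) :
    G m k (0, j + d) ≤ G (m + d) k (0, j) := by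
  have hb := rate_pos hb₁ hb₂
  induction d generalizing m with
  | zero => simp
  | succ d ih =>
    have h1 := lead_hit_le (τ₁ := q + 2) (τ₂ := q + 2 + Δ) (g := g) hθ hb m k (0, j + d)
    rw [h (j + d) (by omega) (by omega)] at h1
    have h2 := ih (fun i i1 i2 => h i i1 (by omega)) (m + 1)
    rw [show m + (d + 1) = m + 1 + d by omega]
    exact h1.trans h2

/-- One period of the cycle of a safe policy. -/
lemma Safe.exists_period (hθ : 0 < θ) (hb₁ : 0 < b₁) (hb₂ : 0 < b₂) {β : ℝ}
    (hβ : IsCycleRate θ b₁ b₂ q Δ β) (h : SafeFor (q + 1) (1, 0)) :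
    ∃ L, 0 < L ∧ L ≤ Δ + 2 ∧ ∀ m, q + 2 ≤ m →
      L * β + G m (q + 1) (1, 0) ≤ G (m + L) (q + 1) (1, 0) := by
  have hb := rate_pos hb₁ hb₂
  have g1 : g (1, 0) = .one := h.eq_one hθ hb₁ hb₂ (by simp only; omega)
  have hs := h.hit hθ hb
  rw [g1] at hs
  change SafeFor (q + 1) (0, 1) at hs
  obtain ⟨k, k1, k2, k3, k4, k5⟩ := hs.exists_two hθ hb₁ hb₂
  have step1 (m : ℕ) : G (m + 1) (q + 1) (1, 0) = G m (q + 1) (0, 1) + b₁ * G m q (2, 1) := by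
    rw [lead_succ_succ, g1]; rfl
  have stepk (m : ℕ) : G (m + 1) (q + 1) (0, k) = G m (q + 1) (1, 0) + b₂ * G m q (1, k + 1) := by
    rw [lead_succ_succ, k3]; rfl
  have base (m : ℕ) (hm : q + 2 ≤ m) : b₁ ^ (q + 1) * (Real.exp θ - 1) ≤ b₁ * G m q (2, 1) := by
    have := (h.miss hθ hb).pow_le_lead_one (m := m) hθ hb₁ hb₂
      (by simp only [InterDelivery.miss]; omega) (by omega)
    rw [pow_succ', mul_assoc]
    exact mul_le_mul_of_nonneg_left this hb₁.le
  have hk := (k5 k k1 le_rfl).miss hθ hb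
  have long (m : ℕ) (hm : q + 2 ≤ m) (hkΔ : k = Δ + 1) :
      b₂ * (homSum b₁ b₂ q + Real.exp θ * b₂ ^ q) * (Real.exp θ - 1) ≤ b₂ * G m q (1, k + 1) := by
    have := hk.double_le_lead_two (m := m) hθ hb₁ hb₂ (by simp only [InterDelivery.miss]; omega)
      (by simp only [InterDelivery.miss]; omega) (by omega)
    rw [mul_assoc]
    exact mul_le_mul_of_nonneg_left this hb₂.le
  have skip (m : ℕ) (j : ℕ) (hj : 1 ≤ j) (hjk : j ≤ k) :
      G m (q + 1) (0, j) ≤ G (m + (j - 1)) (q + 1) (0, 1) := by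
    have := lead_le_of_one (θ := θ) (q := q) (Δ := Δ) (g := g) hθ hb₁ hb₂ (j := 1) (d := j - 1)
      (fun i i1 i2 => k4 i i1 (by omega)) m (q + 1)
    rwa [show 1 + (j - 1) = j by omega] at this
  refine ⟨k + 1, by omega, by omega, fun m hm => ?_⟩
  rw [← add_assoc, step1]
  have hkk := skip (m + 1) k k1 le_rfl
  rw [show m + 1 + (k - 1) = m + k by omega, stepk] at hkk
  -- A failure at (1,0) always costs `b₁ ^ (q + 1)`. A failure at (0,k) leads to (1,k+1): its weight
  -- is discarded for k < Δ, that state is tied for k = Δ, and client 2 has no spare slot there for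
  -- k = Δ + 1.
  rcases Nat.lt_trichotomy k Δ with hkΔ | hkΔ | hkΔ
  · have h1 := hβ.short (by omega)
    have h2 : ((k + 1 : ℕ) : ℝ) * β ≤ Δ * β := by
      have : ((k + 1 : ℕ) : ℝ) ≤ Δ := by exact_mod_cast hkΔ
      exact mul_le_mul_of_nonneg_right this hβ.nonneg
    have h3 := base (m + k) (by omega)
    have h4 := mul_nonneg hb₂.le
      (lead_nonneg (τ₁ := q + 2) (τ₂ := q + 2 + Δ) (g := g) hθ hb m q (1, k + 1))
    linarith
  · have h1 := hβ.diag (by omega)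
    have h2 : homSum b₁ b₂ q * (Real.exp θ - 1) ≤ G m q (1, k + 1) :=
      hk.homSum_le_lead hθ hb₁ hb₂ (by simp only [InterDelivery.miss]; omega)
        (by simp only [InterDelivery.miss]; omega) (by omega)
    have h3 := base (m + k) (by omega)
    have h4 := mul_le_mul_of_nonneg_left h2 hb₂.le
    have h5 : ((k + 1 : ℕ) : ℝ) = Δ + 1 := by rw [hkΔ]; push_cast; ring
    rw [h5]
    linarith
  · have hkΔ' : k = Δ + 1 := by omega
    have h1 := long m hm hkΔ'
    rcases Nat.eq_zero_or_pos Δ with hΔ | hΔ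
    · have h2 : (homSum b₁ b₂ q + Real.exp θ * b₁ ^ q) * (Real.exp θ - 1) ≤ G (m + k) q (2, 1) :=
        (h.miss hθ hb).double_le_lead_one hθ hb₁ hb₂ (by simp only [InterDelivery.miss]; omega)
          (by simp only [InterDelivery.miss]; omega) (by omega)
      have h3 := hβ.equal hΔ
      have h4 := mul_le_mul_of_nonneg_left h2 hb₁.le
      have h5 : ((k + 1 : ℕ) : ℝ) = 2 := by rw [hkΔ', hΔ]; norm_num
      rw [h5]
      linarith
    · have gΔ := k4 Δ (by omega) (by omega)
      -- On the longest cycle client 1 is also served in (0,Δ), where a failure leads to the tied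
      -- state (1,Δ+1) and adds `b₁ * homSum b₁ b₂ q`.
      have stepΔ : G (m + 1 + 1) (q + 1) (0, Δ) =
          G (m + 1) (q + 1) (0, k) + b₁ * G (m + 1) q (1, Δ + 1) := by
        rw [lead_succ_succ, gΔ, hkΔ']; rfl
      have h2 : homSum b₁ b₂ q * (Real.exp θ - 1) ≤ G (m + 1) q (1, Δ + 1) :=
        ((k5 Δ (by omega) (by omega)).miss hθ hb).homSum_le_lead hθ hb₁ hb₂
          (by simp only [InterDelivery.miss]; omega)
          (by simp only [InterDelivery.miss]; omega) (by omega)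
      have h3 := skip (m + 1 + 1) Δ (by omega) (by omega)
      rw [show m + 1 + 1 + (Δ - 1) = m + k by omega, stepΔ, stepk] at h3
      have h4 := mul_le_mul_of_nonneg_left h2 hb₁.le
      have h5 := base (m + k) (by omega)
      have h6 := hβ.long (by omega)
      have h7 : ((k + 1 : ℕ) : ℝ) = Δ + 2 := by rw [hkΔ']; push_cast; ring
      rw [h7]
      linarith

/-- Periods are summed; the offset `q + Δ + 4` bounds the horizon `q + 2` required by one period
plus its length, below which nonnegativity suffices. -/
lemma Safe.linear_le_lead (hθ : 0 < θ) (hb₁ : 0 < b₁) (hb₂ : 0 < b₂) {β : ℝ}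
    (hβ : IsCycleRate θ b₁ b₂ q Δ β) (h : SafeFor (q + 1) (1, 0)) (m : ℕ) :
    β * (m - (q + Δ + 4)) ≤ G m (q + 1) (1, 0) := by
  obtain ⟨L, hL, hL', hp⟩ := h.exists_period hθ hb₁ hb₂ hβ
  induction m using Nat.strong_induction_on with
  | _ m ih =>
    by_cases hm : m < q + 2 + L
    · have h1 : (m : ℝ) ≤ q + Δ + 4 := by
        have : m ≤ q + Δ + 4 := by omega
        exact_mod_cast this
      have h2 : β * ((m : ℝ) - (q + Δ + 4)) ≤ 0 :=
        mul_nonpos_of_nonneg_of_nonpos hβ.nonneg (by linarith)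
      exact h2.trans (lead_nonneg hθ (rate_pos hb₁ hb₂) _ _ _)
    · obtain ⟨m, rfl⟩ : ∃ m', m = m' + L := ⟨m - L, by omega⟩
      have h1 := hp m (by omega)
      have h2 := ih m (by omega)
      push_cast
      linarith

/-- From every safe state the success path leads to `(1, 0)`. -/
lemma Safe.exists_hit (hθ : 0 < θ) (hb₁ : 0 < b₁) (hb₂ : 0 < b₂) {z : ℕ × ℕ}
    (h : SafeFor (q + 1) z) : SafeFor (q + 1) (1, 0) ∧
      ∀ m, G m (q + 1) (1, 0) ≤ G (m + (Δ + 3)) (q + 1) z := by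
  have hb := rate_pos hb₁ hb₂
  have from_zero (j : ℕ) (hj : SafeFor (q + 1) (0, j)) : SafeFor (q + 1) (1, 0) ∧
      ∀ m, G m (q + 1) (1, 0) ≤ G (m + (Δ + 2)) (q + 1) (0, j) := by
    obtain ⟨k, k1, k2, k3, k4, k5⟩ := hj.exists_two hθ hb₁ hb₂
    have hs := (k5 k k1 le_rfl).hit hθ hb
    rw [k3] at hs
    refine ⟨hs, fun m => ?_⟩
    have h1 := lead_hit_le (τ₁ := q + 2) (τ₂ := q + 2 + Δ) (g := g) hθ hb m (q + 1) (0, k)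
    rw [k3] at h1
    have h2 := lead_le_of_one (θ := θ) (q := q) (Δ := Δ) (g := g) hθ hb₁ hb₂ (j := j) (d := k - j)
      (fun i i1 i2 => k4 i i1 (by omega)) (m + 1) (q + 1)
    rw [show j + (k - j) = k by omega] at h2
    exact h1.trans (h2.trans (lead_mono hθ hb _ _ (by omega)))
  have hs := h.hit hθ hb
  have h1 (m : ℕ) := lead_hit_le (τ₁ := q + 2) (τ₂ := q + 2 + Δ) (g := g) hθ hb m (q + 1) z
  rcases hit_cases (g z) z with h2 | h2
  · rw [h2.2] at hs h1
    obtain ⟨h3, h4⟩ := from_zero _ hs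
    exact ⟨h3, fun m => (h4 m).trans (h1 (m + (Δ + 2)))⟩
  · rw [h2.2] at hs h1
    -- Client 1 must still tolerate `q` failures after going unserved, so its age was 0.
    have h3 := (hs.lt hθ hb).1
    simp only at h3
    have h4 : z.1 = 0 := by omega
    rw [h4] at hs h1
    exact ⟨hs, fun m => (h1 m).trans (lead_mono hθ hb _ _ (by omega))⟩

/-- Under any policy, either fewer than `q + 1` failures may lead to a violation, or the critical
weight grows at least at rate `β`. -/
lemma exists_lead_pos_or_linear_le (hθ : 0 < θ) (hb₁ : 0 < b₁) (hb₂ : 0 < b₂) {β : ℝ}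
    (hβ : IsCycleRate θ b₁ b₂ q Δ β) (z : ℕ × ℕ) :
    (∃ m, ∃ k < q + 1, 0 < G m k z) ∨
      ∀ m : ℕ, β * (m - (q + 2 * Δ + 7)) ≤ G m (q + 1) z := by
  have hb := rate_pos hb₁ hb₂
  by_cases h : SafeFor (q + 1) z
  · right
    obtain ⟨h1, h2⟩ := h.exists_hit hθ hb₁ hb₂
    intro m
    by_cases hm : m < Δ + 3
    · have h1 : (m : ℝ) < Δ + 3 := by exact_mod_cast hm
      have h2 : β * ((m : ℝ) - (q + 2 * Δ + 7)) ≤ 0 :=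
        mul_nonpos_of_nonneg_of_nonpos hβ.nonneg (by
          have : (0 : ℝ) ≤ q := by positivity
          have : (0 : ℝ) ≤ Δ := by positivity
          linarith)
      exact h2.trans (lead_nonneg hθ hb _ _ _)
    · obtain ⟨m, rfl⟩ : ∃ m', m = m' + (Δ + 3) := ⟨m - (Δ + 3), by omega⟩
      have h3 := h1.linear_le_lead hθ hb₁ hb₂ hβ m
      have h4 := h2 m
      push_cast
      linarith
  · left
    unfold Safe at h
    push Not at h
    obtain ⟨m, k, hk, h⟩ := h
    exact ⟨m, k, hk, lt_of_le_of_ne (lead_nonneg hθ hb _ _ _) (Ne.symm h)⟩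

end cycle

/-! ### Exact critical weights of the MLG policy -/

/-- The MLG policy for the thresholds `q + 2` and `q + 2 + Δ` on untruncated elapsed times. -/
def mlgNat (q Δ : ℕ) (z : ℕ × ℕ) : Client :=
  if z.1 = 0 ∧ z.2 + 1 = Δ then .two
  else if q + 2 + Δ - z.2 ≤ q + 2 - z.1 then .two
  else .one

lemma mlg_truncate (q Δ : ℕ) (z : ℕ × ℕ) :
    mlg (q + 2) Δ (truncate (q + 2) (q + 2 + Δ) z) = mlgNat q Δ z := by
  have h1 : (min z.1 (q + 2) = 0 ∧ min z.2 (q + 2 + Δ) + 1 = Δ) ↔ (z.1 = 0 ∧ z.2 + 1 = Δ) := by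
    omega
  have h2 : (q + 2 + Δ - min z.2 (q + 2 + Δ) ≤ q + 2 - min z.1 (q + 2)) ↔
      (q + 2 + Δ - z.2 ≤ q + 2 - z.1) := by omega
  simp only [mlg, truncate, mlgNat, h1, h2]

section mlg
variable {θ b₁ b₂ : ℝ} {q Δ : ℕ}

local notation "G" => lead θ (rate b₁ b₂) (q + 2) (q + 2 + Δ) (mlgNat q Δ)

lemma mlgNat_eq_one {z : ℕ × ℕ} (h : ¬(z.1 = 0 ∧ z.2 + 1 = Δ))
    (h' : q + 2 - z.1 < q + 2 + Δ - z.2) : mlgNat q Δ z = .one := by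
  rw [mlgNat, if_neg h, if_neg (by omega)]

lemma mlgNat_eq_two {z : ℕ × ℕ} (h : q + 2 + Δ - z.2 ≤ q + 2 - z.1) : mlgNat q Δ z = .two := by
  rw [mlgNat, if_pos h, ite_self]

/-- States from which `k` failures are harmless under MLG. -/
lemma lead_mlg_eq_zero {m k : ℕ} {z : ℕ × ℕ} (hk : k ≤ q) (h₁ : z.1 + k + 1 ≤ q + 2)
    (h₂ : z.2 + k + 1 ≤ q + 2 + Δ) (h : z.1 + k + 2 ≤ q + 2 ∨ z.2 + k + 2 ≤ q + 2 + Δ) :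
    G m k z = 0 := by
  induction m generalizing k z with
  | zero => simp [lead]
  | succ m ih =>
    -- One client may have only `k + 1` slots left, not both. Off the exceptional state MLG serves
    -- the one with less slack, so the other can afford to age; in `(0, Δ - 1)` client 1 has just
    -- been reset.
    have hs : G m k (hit (mlgNat q Δ z) z) = 0 := by
      unfold mlgNat
      split_ifs with c1 c2
      · apply ih <;> (try simp only [hit]) <;> omega
      · apply ih <;> (try simp only [hit]) <;> omega
      · apply ih <;> (try simp only [hit]) <;> omega
    cases k with
    | zero =>
      have hv : overdue (q + 2) (q + 2 + Δ) z = 0 := by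
        rw [overdue, if_neg (by omega), if_neg (by omega)]
      rw [lead_succ_zero, hs, hv]
      simp
    | succ k =>
      have hF : G m k (miss z) = 0 := by
        apply ih <;> (try simp only [miss]) <;> omega
      rw [lead_succ_succ, hs, hF]
      simp

/-- The bound of `Safe.pow_le_lead_one` is attained, because any success returns to a state harmless
by `lead_mlg_eq_zero`. The further `lead_mlg_*` formulas sharpen the other lower bounds similarly.
-/
lemma lead_mlg_line_one {m k : ℕ} {z : ℕ × ℕ} (hk : k ≤ q) (h₁ : z.1 + k = q + 2)
    (h₂ : z.2 + k + 2 ≤ q + 2 + Δ) (hm : k < m) :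
    G m k z = b₁ ^ k * (Real.exp θ - 1) := by
  induction k generalizing m z with
  | zero =>
    obtain ⟨m, rfl⟩ := Nat.exists_eq_succ_of_ne_zero (by omega : m ≠ 0)
    have hv : overdue (q + 2) (q + 2 + Δ) z = 1 := by
      rw [overdue, if_pos (by omega), if_neg (by omega)]
    rw [lead_succ_zero, hv, mlgNat_eq_one (by omega) (by omega)]
    rw [lead_mlg_eq_zero (by omega)] <;> (try simp only [hit]) <;> first | omega | simp
  | succ k ih =>
    obtain ⟨m, rfl⟩ := Nat.exists_eq_succ_of_ne_zero (by omega : m ≠ 0)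
    rw [lead_succ_succ, mlgNat_eq_one (by omega) (by omega), lead_mlg_eq_zero hk, ih (by omega)]
      <;> (try simp only [hit, miss]) <;> first | omega | skip
    simp only [rate]
    ring

lemma lead_mlg_line_two {m k : ℕ} {z : ℕ × ℕ} (hk : k ≤ q) (h₁ : z.1 + k + 2 ≤ q + 2)
    (h₂ : z.2 + k = q + 2 + Δ) (hm : k < m) :
    G m k z = b₂ ^ k * (Real.exp θ - 1) := by
  induction k generalizing m z with
  | zero =>
    obtain ⟨m, rfl⟩ := Nat.exists_eq_succ_of_ne_zero (by omega : m ≠ 0)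
    have hv : overdue (q + 2) (q + 2 + Δ) z = 1 := by
      rw [overdue, if_neg (by omega), if_pos (by omega)]
    rw [lead_succ_zero, hv, mlgNat_eq_two (by omega)]
    rw [lead_mlg_eq_zero (by omega)] <;> (try simp only [hit]) <;> first | omega | simp
  | succ k ih =>
    obtain ⟨m, rfl⟩ := Nat.exists_eq_succ_of_ne_zero (by omega : m ≠ 0)
    rw [lead_succ_succ, mlgNat_eq_two (by omega), lead_mlg_eq_zero hk, ih (by omega)]
      <;> (try simp only [hit, miss]) <;> first | omega | skip
    simp only [rate]
    ring

lemma lead_mlg_diag {m k : ℕ} {z : ℕ × ℕ} (hk : k ≤ q) (h₁ : z.1 + k + 1 = q + 2)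
    (h₂ : z.2 + k + 1 = q + 2 + Δ) (hm : k + 1 < m) :
    G m k z = homSum b₁ b₂ k * (Real.exp θ - 1) := by
  induction k generalizing m z with
  | zero =>
    obtain ⟨m, rfl⟩ := Nat.exists_eq_succ_of_ne_zero (by omega : m ≠ 0)
    have hv : overdue (q + 2) (q + 2 + Δ) z = 0 := by
      rw [overdue, if_neg (by omega), if_neg (by omega)]
    rw [lead_succ_zero, hv, mlgNat_eq_two (by omega), homSum_zero]
    rw [lead_mlg_line_one (by omega)] <;> (try simp only [hit]) <;> first | omega | simp
  | succ k ih =>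
    obtain ⟨m, rfl⟩ := Nat.exists_eq_succ_of_ne_zero (by omega : m ≠ 0)
    rw [lead_succ_succ, mlgNat_eq_two (by omega), lead_mlg_line_one hk, ih (by omega)]
      <;> (try simp only [hit, miss]) <;> first | omega | skip
    simp only [rate, homSum_succ']
    ring

lemma lead_mlg_double_two {m k : ℕ} {z : ℕ × ℕ} (hk : k ≤ q) (h₁ : z.1 + k + 1 = q + 2)
    (h₂ : z.2 + k = q + 2 + Δ) (hm : k + 1 < m) :
    G m k z = (homSum b₁ b₂ k + Real.exp θ * b₂ ^ k) * (Real.exp θ - 1) := by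
  induction k generalizing m z with
  | zero =>
    obtain ⟨m, rfl⟩ := Nat.exists_eq_succ_of_ne_zero (by omega : m ≠ 0)
    have hv : overdue (q + 2) (q + 2 + Δ) z = 1 := by
      rw [overdue, if_neg (by omega), if_pos (by omega)]
    rw [lead_succ_zero, hv, mlgNat_eq_two (by omega), homSum_zero, lead_mlg_line_one (by omega)]
      <;> (try simp only [hit]) <;> first | omega | skip
    simp
    ring
  | succ k ih =>
    obtain ⟨m, rfl⟩ := Nat.exists_eq_succ_of_ne_zero (by omega : m ≠ 0)
    rw [lead_succ_succ, mlgNat_eq_two (by omega), lead_mlg_line_one hk, ih (by omega)]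
      <;> (try simp only [hit, miss]) <;> first | omega | skip
    simp only [rate, homSum_succ']
    ring

lemma lead_mlg_double_one {m k : ℕ} {z : ℕ × ℕ} (hk : k ≤ q) (h₁ : z.1 + k = q + 2)
    (h₂ : z.2 + k + 1 = q + 2 + Δ) (hm : k + 1 < m) :
    G m k z = (homSum b₁ b₂ k + Real.exp θ * b₁ ^ k) * (Real.exp θ - 1) := by
  induction k generalizing m z with
  | zero =>
    obtain ⟨m, rfl⟩ := Nat.exists_eq_succ_of_ne_zero (by omega : m ≠ 0)
    have hv : overdue (q + 2) (q + 2 + Δ) z = 1 := by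
      rw [overdue, if_pos (by omega), if_neg (by omega)]
    rw [lead_succ_zero, hv, mlgNat_eq_one (by omega) (by omega), homSum_zero,
      lead_mlg_line_two (by omega)]
      <;> (try simp only [hit]) <;> first | omega | skip
    simp
    ring
  | succ k ih =>
    obtain ⟨m, rfl⟩ := Nat.exists_eq_succ_of_ne_zero (by omega : m ≠ 0)
    rw [lead_succ_succ, mlgNat_eq_one (by omega) (by omega), lead_mlg_line_two hk, ih (by omega)]
      <;> (try simp only [hit, miss]) <;> first | omega | skip
    simp only [rate, homSum_succ]
    ring

lemma lead_mlg_one_zero (m : ℕ) :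
    G (m + 1) (q + 1) (1, 0) = G m (q + 1) (0, 1) + b₁ * G m q (2, 1) := by
  rw [lead_succ_succ, mlgNat_eq_one (by simp) (by simp only; omega)]
  rfl

lemma lead_mlg_zero_of_two {j : ℕ} (hj : mlgNat q Δ (0, j) = .two) (m : ℕ) :
    G (m + 1) (q + 1) (0, j) = G m (q + 1) (1, 0) + b₂ * G m q (1, j + 1) := by
  rw [lead_succ_succ, hj]
  rfl

/-- Before client 2 becomes urgent, a failure leads to a state still tolerating `q` more failures,
so these slots of the cycle carry no weight. -/
lemma lead_mlg_zero_add {j d : ℕ} (h : j + d + 1 ≤ Δ) (m : ℕ) :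
    G (m + d) (q + 1) (0, j) = G m (q + 1) (0, j + d) := by
  induction d generalizing m with
  | zero => rfl
  | succ d ih =>
    rw [show m + (d + 1) = m + 1 + d by omega, ih (by omega), lead_succ_succ,
      mlgNat_eq_one (by simp only; omega) (by simp only; omega),
      lead_mlg_eq_zero (k := q) le_rfl (by simp only [miss]; omega) (by simp only [miss]; omega)
        (by simp only [miss]; omega), mul_zero, add_zero]
    rfl

/-- The period of the MLG cycle. -/
def mlgPeriod (Δ : ℕ) : ℕ := if Δ = 0 then 2 else if Δ = 1 then 2 else Δ

/-- The critical weight of one period of the MLG cycle. -/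
def mlgWeight (θ b₁ b₂ : ℝ) (q Δ : ℕ) : ℝ :=
  (if Δ = 0 then b₁ * (homSum b₁ b₂ q + Real.exp θ * b₁ ^ q)
    + b₂ * (homSum b₁ b₂ q + Real.exp θ * b₂ ^ q)
  else if Δ = 1 then b₁ ^ (q + 1) + b₂ * homSum b₁ b₂ q
  else b₁ ^ (q + 1)) * (Real.exp θ - 1)

lemma mlgPeriod_pos (Δ : ℕ) : 0 < mlgPeriod Δ := by
  unfold mlgPeriod; split_ifs <;> omega

lemma lead_mlg_period {m : ℕ} (hm : q + 2 ≤ m) :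
    G (m + mlgPeriod Δ) (q + 1) (1, 0) = G m (q + 1) (1, 0) + mlgWeight θ b₁ b₂ q Δ := by
  unfold mlgPeriod mlgWeight
  split_ifs with h0 h1
  · subst h0
    rw [show m + 2 = m + 1 + 1 from rfl, lead_mlg_one_zero,
      lead_mlg_zero_of_two (mlgNat_eq_two (by simp)),
      lead_mlg_double_two (k := q) le_rfl (by simp only; omega) (by simp only; omega) (by omega),
      lead_mlg_double_one (k := q) le_rfl (by simp only; omega) (by simp only; omega) (by omega)]
    ring
  · subst h1
    rw [show m + 2 = m + 1 + 1 from rfl, lead_mlg_one_zero,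
      lead_mlg_zero_of_two (mlgNat_eq_two (by simp)),
      lead_mlg_diag (k := q) le_rfl (by simp only; omega) (by simp only; omega) (by omega),
      lead_mlg_line_one (k := q) le_rfl (by simp only; omega) (by simp only; omega) (by omega)]
    ring
  -- This is the exceptional state `(0, Δ - 1)`: serving client 2 there shortens the period to `Δ`
  -- and leaves only the weight at (1,0).
  · have e : mlgNat q Δ (0, 1 + (Δ - 2)) = .two := by
      rw [mlgNat, if_pos ⟨rfl, by change 1 + (Δ - 2) + 1 = Δ; omega⟩]
    rw [show m + Δ = m + 1 + (Δ - 2) + 1 by omega, lead_mlg_one_zero,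
      lead_mlg_zero_add (by omega), lead_mlg_zero_of_two e,
      lead_mlg_eq_zero (k := q) le_rfl (by simp only; omega) (by simp only; omega)
        (by simp only; omega),
      lead_mlg_line_one (k := q) le_rfl (by simp only; omega) (by simp only; omega) (by omega)]
    ring

lemma safe_mlg :
    Safe θ (rate b₁ b₂) (q + 2) (q + 2 + Δ) (mlgNat q Δ) (q + 1) (1, 0) := fun m j hj =>
  lead_mlg_eq_zero (by omega) (by simp only; omega) (by simp only; omega) (by simp only; omega)

/-- Under MLG the success path from every state leads to `(1, 0)`. -/
lemma exists_iterate_mlg (q Δ : ℕ) (z : ℕ × ℕ) :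
    ∃ d, (fun w => hit (mlgNat q Δ w) w)^[d] z = (1, 0) := by
  have step {w : ℕ × ℕ} (h : ∃ d, (fun w => hit (mlgNat q Δ w) w)^[d]
      (hit (mlgNat q Δ w) w) = (1, 0)) :
      ∃ d, (fun w => hit (mlgNat q Δ w) w)^[d] w = (1, 0) := by
    obtain ⟨d, hd⟩ := h
    exact ⟨d + 1, by rwa [Function.iterate_succ_apply]⟩
  have from_zero (c j : ℕ) (hc : Δ ≤ j + c) :
      ∃ d, (fun w => hit (mlgNat q Δ w) w)^[d] (0, j) = (1, 0) := by
    induction c generalizing j with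
    | zero =>
      refine step ⟨0, ?_⟩
      rw [mlgNat_eq_two (by simp only; omega)]
      rfl
    | succ c ih =>
      apply step
      rcases hit_cases (mlgNat q Δ (0, j)) (0, j) with h | h
      · rw [h.2]
        exact ih _ (by simp only; omega)
      · rw [h.2]
        exact ⟨0, rfl⟩
  apply step
  rcases hit_cases (mlgNat q Δ z) z with h | h
  · rw [h.2]
    exact from_zero Δ _ (by omega)
  · rw [h.2]
    apply step
    rcases hit_cases (mlgNat q Δ (z.1 + 1, 0)) (z.1 + 1, 0) with h' | h'
    · rw [h'.2]
      exact from_zero Δ _ (by omega)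
    · exfalso
      have := mlgNat_eq_one (q := q) (Δ := Δ) (z := (z.1 + 1, 0)) (by simp) (by simp only; omega)
      rw [this] at h'
      exact absurd h'.1 (by simp)

end mlg

/-! ### Spreading the growth rate to all states -/

section spread
variable {θ : ℝ} {b : Client → ℝ} {τ₁ τ₂ : ℕ} {g : ℕ × ℕ → Client}

/-- The deviation of the growth of the cost over `L` slots from the rate `1 + κ ε ^ n`. -/
def growthError (θ : ℝ) (b : Client → ℝ) (τ₁ τ₂ : ℕ) (g : ℕ × ℕ → Client) (κ : ℝ) (n L : ℕ)
    (N : ℕ) (z : ℕ × ℕ) (ε : ℝ) : ℝ :=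
  value θ b τ₁ τ₂ g ε (N + L) z - (1 + κ * ε ^ n) * value θ b τ₁ τ₂ g ε N z

lemma growthError_succ (κ : ℝ) (n L N : ℕ) (z : ℕ × ℕ) (ε : ℝ) :
    growthError θ b τ₁ τ₂ g κ n L (N + 1) z ε = Real.exp (θ * overdue τ₁ τ₂ z) *
      ((1 - b (g z) * ε) * growthError θ b τ₁ τ₂ g κ n L N (hit (g z) z) ε
        + b (g z) * ε * growthError θ b τ₁ τ₂ g κ n L N (miss z) ε) := by
  unfold growthError
  rw [Nat.add_right_comm, value, value]
  ring

/-- The order-`n` terms cancel by `hκ`; the product of the two corrections is of order `2 * n ≥ n +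
1`. -/
lemma Safe.growthError_isBigO (hθ : 0 < θ) (hb : ∀ u, 0 < b u) {n L N : ℕ} {κ : ℝ} {z : ℕ × ℕ}
    (hn : 0 < n) (h : Safe θ b τ₁ τ₂ g n z)
    (hκ : lead θ b τ₁ τ₂ g (N + L) n z = lead θ b τ₁ τ₂ g N n z + κ) :
    growthError θ b τ₁ τ₂ g κ n L N z =O[𝓝[>] 0] fun ε : ℝ => ε ^ (n + 1) := by
  have h1 := h.value_isBigO hθ hb (N + L)
  have h2 := h.value_isBigO hθ hb N
  have h3 : (fun ε : ℝ => ε ^ (2 * n)) =O[𝓝[>] 0] fun ε : ℝ => ε ^ (n + 1) :=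
    isBigO_pow_of_le (by omega)
  have h4 := (h1.sub (isBigO_continuous_mul (q := fun ε => 1 + κ * ε ^ n) (by fun_prop) h2)).sub
    (isBigO_continuous_mul (q := fun _ => κ * lead θ b τ₁ τ₂ g N n z) (by fun_prop) h3)
  refine h4.congr_left fun ε => ?_
  unfold growthError
  rw [hκ, two_mul, pow_add]
  ring

/-- A bound for the growth error at one state reached by the success path from everywhere extends
to all states. -/
lemma growthError_isBigO_of_iterate {n L J : ℕ} {κ : ℝ} {w : ℕ × ℕ}
    (hw : ∃ N₀, ∀ N ≥ N₀,
      growthError θ b τ₁ τ₂ g κ n L N w =O[𝓝[>] 0] fun ε : ℝ => ε ^ J)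
    (hit_w : ∀ z, ∃ d, (fun v => hit (g v) v)^[d] z = w) (z : ℕ × ℕ) :
    ∃ N₀, ∀ N ≥ N₀, growthError θ b τ₁ τ₂ g κ n L N z =O[𝓝[>] 0] fun ε : ℝ => ε ^ J := by
  -- The order improves one power at a time. A failure brings its own factor ε, so the weaker bound
  -- suffices there, while a success moves closer to `w`; hence the inner induction on the distance
  -- `d`.
  suffices H : ∀ j ≤ J, ∀ z, ∃ N₀, ∀ N ≥ N₀,
      growthError θ b τ₁ τ₂ g κ n L N z =O[𝓝[>] 0] fun ε : ℝ => ε ^ j from H J le_rfl z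
  intro j
  induction j with
  | zero =>
    intro _ z
    refine ⟨0, fun N _ => ?_⟩
    simp only [pow_zero]
    apply isBigO_one_of_continuous
    unfold growthError
    have h1 := continuous_value (θ := θ) (b := b) (τ₁ := τ₁) (τ₂ := τ₂) (g := g) (N + L) z
    have h2 := continuous_value (θ := θ) (b := b) (τ₁ := τ₁) (τ₂ := τ₂) (g := g) N z
    fun_prop
  | succ j ih =>
    intro hj z
    obtain ⟨d, hd⟩ := hit_w z
    induction d generalizing z with
    | zero =>
      rw [Function.iterate_zero, id_eq] at hd
      obtain ⟨N₀, h⟩ := hw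
      exact ⟨N₀, fun N hN => hd ▸ (h N hN).trans (isBigO_pow_of_le hj)⟩
    | succ d ihd =>
      rw [Function.iterate_succ_apply] at hd
      obtain ⟨N₁, h1⟩ := ihd _ hd
      obtain ⟨N₂, h2⟩ := ih (by omega) (miss z)
      refine ⟨max N₁ N₂ + 1, fun N hN => ?_⟩
      obtain ⟨N, rfl⟩ : ∃ N', N = N' + 1 := ⟨N - 1, by omega⟩
      have h3 := (isBigO_continuous_mul
        (q := fun ε => Real.exp (θ * overdue τ₁ τ₂ z) * (1 - b (g z) * ε)) (by fun_prop)
        (h1 N (by omega))).add (isBigO_continuous_mul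
        (q := fun _ => Real.exp (θ * overdue τ₁ τ₂ z) * b (g z)) (by fun_prop)
        (isBigO_id_pow (h2 N (by omega))))
      refine h3.congr_left fun ε => ?_
      rw [growthError_succ]
      ring

end spread

/-! ### Asymptotics of the average and the optimal cost -/

instance : Finite Client :=
  Finite.of_surjective (fun c : Bool => bif c then Client.one else .two)
    (by rintro (_ | _); exacts [⟨true, rfl⟩, ⟨false, rfl⟩])

section avg
variable {τ₁ τ₂ : ℕ}

lemma eventually_reliability {b₁ b₂ : ℝ} (hb₁ : 0 < b₁) (hb₂ : 0 < b₂) : ∀ᶠ ε : ℝ in 𝓝[>] 0,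
    (∀ u, 0 ≤ reliability b₁ b₂ ε u) ∧ ∀ u, reliability b₁ b₂ ε u ≤ 1 := by
  filter_upwards [eventually_rate_mul_lt_one (rate b₁ b₂), self_mem_nhdsWithin] with ε h hε
  have hε' : 0 < ε := hε
  refine ⟨fun u => ?_, fun u => ?_⟩ <;> rw [reliability_eq]
  · linarith [h u]
  · linarith [mul_pos (rate_pos hb₁ hb₂ u) hε']

lemma sub_sq_le_log_one_add {t : ℝ} (ht : -(1 / 2) ≤ t) : t - 2 * t ^ 2 ≤ Real.log (1 + t) := by
  have h0 : 0 < 1 + t := by linarith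
  refine le_trans ?_ (Real.one_sub_inv_le_log_of_pos h0)
  rw [← sub_nonneg]
  have : 1 - (1 + t)⁻¹ - (t - 2 * t ^ 2) = t ^ 2 * (1 + 2 * t) / (1 + t) := by
    field_simp
    ring
  rw [this]
  exact div_nonneg (mul_nonneg (sq_nonneg t) (by linarith)) h0.le

lemma tendsto_pow_pos {n : ℕ} (hn : 0 < n) : Tendsto (fun ε : ℝ => ε ^ n) (𝓝[>] 0) (𝓝 0) := by
  have := ((continuous_pow n).tendsto (0 : ℝ)).mono_left (nhdsWithin_le_nhds (s := Set.Ioi 0))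
  rwa [zero_pow hn.ne'] at this

/-- The average cost when one period of length `L` multiplies the cost by
`1 + κ ε ^ n + O(ε ^ (n + 1))` from every state. -/
lemma avgCost_isBigO_of_growthError {θ b₁ b₂ κ : ℝ} {n L : ℕ} (hθ : 0 < θ) (hb₁ : 0 < b₁)
    (hb₂ : 0 < b₂) (hn : 0 < n) (hL : 0 < L) (f : Policy τ₁ τ₂)
    (h : ∀ z, ∃ N₀, ∀ N ≥ N₀, growthError θ (rate b₁ b₂) τ₁ τ₂
      (fun w => f (truncate τ₁ τ₂ w)) κ n L N z =O[𝓝[>] 0] fun ε : ℝ => ε ^ (n + 1))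
    (x : State τ₁ τ₂) :
    (fun ε => avgCost θ (reliability b₁ b₂ ε) f x - κ / L / θ * ε ^ n)
      =O[𝓝[>] 0] fun ε : ℝ => ε ^ (n + 1) := by
  choose N₀ hN₀ using h
  -- There are finitely many states, so one horizon works for all of them.
  set N := Finset.univ.sup fun y : State τ₁ τ₂ => N₀ ((y.1 : ℕ), (y.2 : ℕ)) with hN
  set E : State τ₁ τ₂ → ℝ → ℝ := fun y => growthError θ (rate b₁ b₂) τ₁ τ₂
      (fun w => f (truncate τ₁ τ₂ w)) κ n L N ((y.1 : ℕ), (y.2 : ℕ)) with hE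
  have hO : (fun ε => ∑ y, |E y ε|) =O[𝓝[>] 0] fun ε : ℝ => ε ^ (n + 1) :=
    IsBigO.fun_sum fun y _ => (hN₀ _ N (Finset.le_sup (f := fun y : State τ₁ τ₂ =>
      N₀ ((y.1 : ℕ), (y.2 : ℕ))) (Finset.mem_univ y))).abs_left
  obtain ⟨C, hC, hbd⟩ := hO.exists_pos
  rw [isBigOWith_iff] at hbd
  set t : ℝ → ℝ := fun ε => κ * ε ^ n - C * ε ^ (n + 1) with ht
  set s : ℝ → ℝ := fun ε => κ * ε ^ n + C * ε ^ (n + 1) with hs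
  have tt : Tendsto t (𝓝[>] 0) (𝓝 0) := by
    simpa using ((tendsto_pow_pos hn).const_mul κ).sub
      ((tendsto_pow_pos n.succ_pos).const_mul C)
  have ts : Tendsto s (𝓝[>] 0) (𝓝 0) := by
    simpa using ((tendsto_pow_pos hn).const_mul κ).add
      ((tendsto_pow_pos n.succ_pos).const_mul C)
  have ht2 : (fun ε => t ε ^ 2) =O[𝓝[>] 0] fun ε : ℝ => ε ^ (n + 1) := by
    have h1 := isBigO_continuous_mul (q := fun ε : ℝ => (κ - C * ε) ^ 2) (by fun_prop)
      (isBigO_pow_of_le (show n + 1 ≤ 2 * n by omega))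
    refine h1.congr_left fun ε => ?_
    rw [ht]
    ring
  have hr : (fun ε : ℝ => C * ε ^ (n + 1) + 2 * t ε ^ 2) =O[𝓝[>] 0] fun ε : ℝ => ε ^ (n + 1) :=
    ((isBigO_refl _ _).const_mul_left C).add (ht2.const_mul_left 2)
  refine (IsBigO.of_bound (1 / (L * θ)) ?_).trans hr
  filter_upwards [hbd, eventually_reliability hb₁ hb₂, self_mem_nhdsWithin,
    tt.eventually_const_le (show (-(1 / 2) : ℝ) < 0 by norm_num),
    ts.eventually_const_le (show (-(1 / 2) : ℝ) < 0 by norm_num)] with ε h1 ⟨hp, hp1⟩ hε h2 h3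
  have hε' : 0 < ε := hε
  have hL' : (0 : ℝ) < L := by exact_mod_cast hL
  have hEy (y) : |E y ε| ≤ C * ε ^ (n + 1) := by
    refine (Finset.single_le_sum (f := fun y => |E y ε|) (fun _ _ => abs_nonneg _)
      (Finset.mem_univ y)).trans ((le_abs_self _).trans ?_)
    have h4 : ‖ε ^ (n + 1)‖ = ε ^ (n + 1) := Real.norm_of_nonneg (by positivity)
    rwa [h4, Real.norm_eq_abs] at h1
  have hEv (y : State τ₁ τ₂) : horizonCost θ (reliability b₁ b₂ ε) f (N + L) y =
      (1 + κ * ε ^ n) * horizonCost θ (reliability b₁ b₂ ε) f N y + E y ε := by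
    rw [horizonCost_eq_value, horizonCost_eq_value, hE]
    simp only [growthError]
    ring
  have hCe : 0 ≤ C * ε ^ (n + 1) := by positivity
  -- As the cost is at least 1, the additive error `E` is absorbed into the growth factors `1 + s ε`
  -- and `1 + t ε`.
  have hV (y) := one_le_horizonCost (θ := θ) hθ hp hp1 f N y
  have hup : avgCost θ (reliability b₁ b₂ ε) f x ≤ s ε / L / θ := by
    have h4 := avgCost_le (lam := 1 + s ε) (N := N) hθ hp hp1 f hL (by linarith) (fun y => by
      rw [hEv y, hs]
      nlinarith [le_abs_self (E y ε), hEy y, hV y]) x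
    have h5 := Real.log_le_sub_one_of_pos (show 0 < 1 + s ε by linarith)
    refine h4.trans ?_
    gcongr
    linarith
  have hlo : (t ε - 2 * t ε ^ 2) / L / θ ≤ avgCost θ (reliability b₁ b₂ ε) f x := by
    have h4 := le_avgCost (lam := 1 + t ε) (N := N) hθ hp hp1 f hL (by linarith) (fun y => by
      rw [hEv y, ht]
      nlinarith [neg_abs_le (E y ε), hEy y, hV y]) x
    refine le_trans ?_ h4
    gcongr
    exact sub_sq_le_log_one_add h2
  have hnn : 0 ≤ C * ε ^ (n + 1) + 2 * t ε ^ 2 := by positivity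
  rw [Real.norm_eq_abs, Real.norm_eq_abs, abs_of_nonneg hnn, abs_le]
  have e1 : s ε / L / θ = κ / L / θ * ε ^ n + 1 / (L * θ) * (C * ε ^ (n + 1)) := by
    rw [hs]; field_simp
  have e2 : (t ε - 2 * t ε ^ 2) / L / θ =
      κ / L / θ * ε ^ n - 1 / (L * θ) * (C * ε ^ (n + 1) + 2 * t ε ^ 2) := by
    simp only [ht]; field_simp; ring
  have e3 : 0 ≤ 1 / (L * θ) * (2 * t ε ^ 2) := by positivity
  constructor <;> linarith

/-- A lower bound on the average cost of all policies from the rate of all safe cycles. -/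
lemma eventually_le_optCost {θ b₁ b₂ β : ℝ} {q Δ : ℕ} (hθ : 0 < θ) (hb₁ : 0 < b₁)
    (hb₂ : 0 < b₂) (hβ : IsCycleRate θ b₁ b₂ q Δ β) (x : State (q + 2) (q + 2 + Δ)) {δ : ℝ}
    (hδ : 0 < δ) : ∀ᶠ ε : ℝ in 𝓝[>] 0,
      (β - δ) / θ * ε ^ (q + 1) ≤ optCost θ (reliability b₁ b₂ ε) x := by
  have hb := rate_pos hb₁ hb₂
  have key (f : Policy (q + 2) (q + 2 + Δ)) (y : State (q + 2) (q + 2 + Δ)) :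
      ∀ᶠ B : ℕ in atTop, ∀ᶠ ε : ℝ in 𝓝[>] 0,
        1 + (β - δ / 2) * B * ε ^ (q + 1) ≤ horizonCost θ (reliability b₁ b₂ ε) f B y := by
    set z : ℕ × ℕ := ((y.1 : ℕ), (y.2 : ℕ))
    rcases exists_lead_pos_or_linear_le (g := fun w => f (truncate _ _ w)) hθ hb₁ hb₂ hβ z
      with ⟨m, k, hk, hpos⟩ | hlin
    · filter_upwards [eventually_ge_atTop m] with B hB
      obtain ⟨r, hr, hle⟩ := exists_lead_le_value (τ₁ := q + 2) (τ₂ := q + 2 + Δ)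
        (g := fun w => f (truncate _ _ w)) hθ hb B k z
      have hG := hpos.trans_le (lead_mono hθ hb k z hB)
      set a := lead θ (rate b₁ b₂) (q + 2) (q + 2 + Δ) (fun w => f (truncate _ _ w)) B k z
      -- In this case a term of order `k ≤ q` dominates every multiple of `ε ^ (q + 1)`.
      have ho : (fun ε => (β - δ / 2) * B * ε ^ (q + 1) - r ε) =o[𝓝[>] 0] fun ε : ℝ => ε ^ k := by
        have h1 : (fun ε : ℝ => ε ^ (k + 1)) =o[𝓝[>] 0] fun ε : ℝ => ε ^ k :=
          (isLittleO_pow_pow (𝕜 := ℝ) (Nat.lt_succ_self k)).mono nhdsWithin_le_nhds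
        exact (((isBigO_pow_of_le (show k + 1 ≤ q + 1 by omega)).const_mul_left _).sub
          hr).trans_isLittleO h1
      filter_upwards [hle, ho.def hG, self_mem_nhdsWithin] with ε h1 h2 hε
      have hε' : 0 < ε := hε
      rw [horizonCost_eq_value]
      rw [Real.norm_of_nonneg (by positivity : 0 ≤ ε ^ k), Real.norm_eq_abs] at h2
      linarith [le_abs_self ((β - δ / 2) * B * ε ^ (q + 1) - r ε)]
    -- The slack `δ / 2` per slot eventually outweighs the constant offset in the linear bound.
    · have hlim : Tendsto (fun B : ℕ => (B : ℝ) * (δ / 2)) atTop atTop :=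
        tendsto_natCast_atTop_atTop.atTop_mul_const (by positivity)
      filter_upwards [hlim.eventually_gt_atTop (β * (q + 2 * Δ + 7))] with B hB
      obtain ⟨r, hr, hle⟩ := exists_lead_le_value (τ₁ := q + 2) (τ₂ := q + 2 + Δ)
        (g := fun w => f (truncate _ _ w)) hθ hb B (q + 1) z
      have hG := hlin B
      set a := lead θ (rate b₁ b₂) (q + 2) (q + 2 + Δ) (fun w => f (truncate _ _ w)) B (q + 1) z
      have hpos : 0 < a - (β - δ / 2) * B := by linarith
      have ho : r =o[𝓝[>] 0] fun ε : ℝ => ε ^ (q + 1) :=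
        hr.trans_isLittleO
          ((isLittleO_pow_pow (𝕜 := ℝ) (Nat.lt_succ_self _)).mono nhdsWithin_le_nhds)
      filter_upwards [hle, ho.def hpos, self_mem_nhdsWithin] with ε h1 h2 hε
      have hε' : 0 < ε := hε
      rw [horizonCost_eq_value]
      rw [Real.norm_of_nonneg (by positivity : 0 ≤ ε ^ (q + 1)), Real.norm_eq_abs] at h2
      linarith [neg_abs_le (r ε)]
  -- One horizon `B` for all policies and states; it is then used as a period, starting from horizon
  -- 0, where the cost is 1.
  obtain ⟨B, hB, hB0⟩ := ((eventually_all.2 fun f => eventually_all.2 fun y => key f y).and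
    (eventually_gt_atTop 0)).exists
  set t : ℝ → ℝ := fun ε => (β - δ / 2) * B * ε ^ (q + 1) with ht
  have tt : Tendsto t (𝓝[>] 0) (𝓝 0) := by
    simpa using (tendsto_pow_pos q.succ_pos).const_mul ((β - δ / 2) * B)
  have hB' : (0 : ℝ) < B := by exact_mod_cast hB0
  have ho : (fun ε => 2 * t ε ^ 2) =o[𝓝[>] 0] fun ε : ℝ => ε ^ (q + 1) := by
    have h1 : (fun ε : ℝ => ε ^ (2 * (q + 1))) =o[𝓝[>] 0] fun ε : ℝ => ε ^ (q + 1) :=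
      (isLittleO_pow_pow (𝕜 := ℝ) (by omega)).mono nhdsWithin_le_nhds
    refine (h1.const_mul_left (2 * ((β - δ / 2) * B) ^ 2)).congr_left fun ε => ?_
    rw [ht]
    ring
  filter_upwards [eventually_all.2 fun f => eventually_all.2 fun y => hB f y,
    eventually_reliability hb₁ hb₂, tt.eventually_const_le (show (-(1 / 2) : ℝ) < 0 by norm_num),
    ho.def (show 0 < δ / 2 * B by positivity), self_mem_nhdsWithin] with ε h1 ⟨hp, hp1⟩ h2 h3 hε
  have hε' : 0 < ε := hε
  have : Nonempty (Policy (q + 2) (q + 2 + Δ)) := ⟨fun _ => .one⟩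
  refine le_ciInf fun f => ?_
  have h4 := le_avgCost (lam := 1 + t ε) (N := 0) (L := B) hθ hp hp1 f hB0 (by linarith)
    (fun y => by
    rw [horizonCost_zero, mul_one, zero_add]
    exact h1 f y) x
  refine le_trans ?_ h4
  have h5 := sub_sq_le_log_one_add h2
  rw [Real.norm_of_nonneg (by positivity : 0 ≤ ε ^ (q + 1)),
    Real.norm_of_nonneg (by positivity : 0 ≤ 2 * t ε ^ 2)] at h3
  rw [show (β - δ) / θ * ε ^ (q + 1) = (β - δ) * B * ε ^ (q + 1) / B / θ by field_simp]
  gcongr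
  simp only [ht] at h3 h5 ⊢
  linarith

end avg

/-! ### Comparison of the cycle rates -/

section coefficients
variable {θ b₁ b₂ : ℝ} {q Δ : ℕ}

lemma mul_homSum_le {b₁ b₂ : ℝ} (hb₁ : 0 < b₁) (hb₂ : 0 < b₂) {u : ℝ} (hu : min b₁ b₂ ≤ u)
    (q : ℕ) : ((q : ℝ) + 1) * min b₁ b₂ ^ (q + 1) ≤ u * homSum b₁ b₂ q := by
  have hm : 0 < min b₁ b₂ := lt_min hb₁ hb₂
  have h1 : ((q : ℝ) + 1) * min b₁ b₂ ^ q ≤ homSum b₁ b₂ q := by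
    have : ∑ j ∈ Finset.range (q + 1), min b₁ b₂ ^ q ≤ homSum b₁ b₂ q := by
      refine Finset.sum_le_sum fun j hj => ?_
      have hj' := Finset.mem_range.1 hj
      rw [← Nat.add_sub_cancel' (show j ≤ q by omega), pow_add]
      simp only [Nat.add_sub_cancel' (show j ≤ q by omega)]
      gcongr
      · exact min_le_left _ _
      · exact min_le_right _ _
    simpa using this
  calc ((q : ℝ) + 1) * min b₁ b₂ ^ (q + 1) = min b₁ b₂ * (((q : ℝ) + 1) * min b₁ b₂ ^ q) := by ring
    _ ≤ u * homSum b₁ b₂ q := by gcongr; exact hm.le.trans hu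

lemma homSum_eq_add_sum (b₁ b₂ : ℝ) (q : ℕ) : homSum b₁ b₂ (q + 1) =
    b₂ ^ (q + 1) + ∑ j ∈ Finset.Icc 1 q, b₁ ^ j * b₂ ^ (q + 1 - j) + b₁ ^ (q + 1) := by
  unfold homSum
  rw [Finset.sum_range_succ, Finset.range_eq_Ico, Finset.sum_eq_sum_Ico_succ_bot (by omega)]
  have : Finset.Ico (0 + 1) (q + 1) = Finset.Icc 1 q := by ext; simp
  rw [this]
  simp

lemma sum_Icc_eq_mul_homSum (b₁ b₂ : ℝ) (q : ℕ) :
    ∑ j ∈ Finset.Icc 1 (q + 1), b₂ ^ j * b₁ ^ (q + 1 - j) = b₂ * homSum b₁ b₂ q := by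
  have h := homSum_eq_add_sum b₂ b₁ q
  rw [Finset.sum_Icc_succ_top (by omega), Nat.sub_self, pow_zero, mul_one]
  have h2 := homSum_succ b₂ b₁ q
  rw [homSum_comm b₁ b₂]
  linarith

lemma mlgCoeff_eq (hθ : 0 < θ) :
    mlgCoeff θ b₁ b₂ (q + 2) Δ = mlgWeight θ b₁ b₂ q Δ / mlgPeriod Δ / θ := by
  have e1 := homSum_succ b₁ b₂ q
  have e2 := homSum_succ' b₁ b₂ q
  unfold mlgCoeff mlgWeight mlgPeriod
  split_ifs with h0 h1
  · have e3 := homSum_eq_add_sum b₁ b₂ q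
    have e4 : Real.exp (2 * θ) - 1 = (Real.exp θ + 1) * (Real.exp θ - 1) := by
      rw [two_mul, Real.exp_add]; ring
    rw [A₀, e4, show q + 2 - 2 = q from rfl, show q + 2 - 1 = q + 1 from rfl,
      show ∑ j ∈ Finset.Icc 1 q, b₁ ^ j * b₂ ^ (q + 1 - j) =
        homSum b₁ b₂ (q + 1) - b₁ ^ (q + 1) - b₂ ^ (q + 1) by linarith,
      show b₁ * (homSum b₁ b₂ q + Real.exp θ * b₁ ^ q) =
        homSum b₁ b₂ (q + 1) - b₂ ^ (q + 1) + Real.exp θ * b₁ ^ (q + 1) by rw [e1]; ring,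
      show b₂ * (homSum b₁ b₂ q + Real.exp θ * b₂ ^ q) =
        homSum b₁ b₂ (q + 1) - b₁ ^ (q + 1) + Real.exp θ * b₂ ^ (q + 1) by rw [e2]; ring]
    push_cast
    field_simp
    ring
  · rw [← e2, homSum, show q + 2 - 1 = q + 1 from rfl]
    push_cast
    field_simp
  · rw [show q + 2 - 1 = q + 1 from rfl]
    field_simp

lemma mlgWeight_pos (hθ : 0 < θ) (hb₁ : 0 < b₁) (hb₂ : 0 < b₂) : 0 < mlgWeight θ b₁ b₂ q Δ := by
  have hc : 0 < Real.exp θ - 1 := by linarith [Real.add_one_lt_exp hθ.ne']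
  have hH := homSum_pos hb₁ hb₂ q
  unfold mlgWeight
  split_ifs <;> positivity

/-- The MLG cycle attains the relevant bound; the competing cycles must be shown to have no smaller
ratio. For `Δ ≥ 2` this reduces to `hcrit`, which compares lengths `Δ` and `Δ + 1`. -/
lemma isCycleRate_mlg (hθ : 0 < θ) (hb₁ : 0 < b₁) (hb₂ : 0 < b₂)
    (h : 2 ≤ Δ → b₁ ^ (q + 1) ≤ Δ * ((q : ℝ) + 1) * b₂ ^ (q + 1)) :
    IsCycleRate θ b₁ b₂ q Δ (mlgWeight θ b₁ b₂ q Δ / mlgPeriod Δ) := by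
  have hc : 0 < Real.exp θ - 1 := by linarith [Real.add_one_lt_exp hθ.ne']
  have hH := homSum_pos hb₁ hb₂ q
  have e1 := homSum_succ b₁ b₂ q
  have e2 := homSum_succ' b₁ b₂ q
  have hpow : b₁ ^ (q + 1) ≤ b₁ * homSum b₁ b₂ q := by
    rw [pow_succ']
    refine mul_le_mul_of_nonneg_left ?_ hb₁.le
    have := Finset.single_le_sum (f := fun j => b₁ ^ j * b₂ ^ (q - j))
      (fun j _ => by positivity) (Finset.self_mem_range_succ q)
    simpa [homSum] using this
  have hcrit (hΔ : 2 ≤ Δ) : b₁ ^ (q + 1) ≤ Δ * (b₂ * homSum b₁ b₂ q) := by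
    have hΔ' : (2 : ℝ) ≤ Δ := by exact_mod_cast hΔ
    rcases le_total b₂ b₁ with h12 | h12
    · have h1 := mul_homSum_le hb₁ hb₂ (min_le_right b₁ b₂) q
      rw [min_eq_right h12] at h1
      calc b₁ ^ (q + 1) ≤ Δ * ((q : ℝ) + 1) * b₂ ^ (q + 1) := h hΔ
        _ = Δ * (((q : ℝ) + 1) * b₂ ^ (q + 1)) := by ring
        _ ≤ _ := by gcongr
    -- If `b₁ ≤ b₂`, equating the two expansions of `homSum b₁ b₂ (q + 1)` gives `b₂ ^ (q + 1) ≤ b₂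
    -- * homSum b₁ b₂ q`, using `hpow`.
    · have h1 : b₁ ^ (q + 1) ≤ b₂ ^ (q + 1) := by gcongr
      have h2 : b₂ ^ (q + 1) ≤ b₂ * homSum b₁ b₂ q := by
        have h3 : b₁ * homSum b₁ b₂ q + b₂ ^ (q + 1) = b₁ ^ (q + 1) + b₂ * homSum b₁ b₂ q := by
          linarith
        linarith
      have h5 : 0 < b₂ * homSum b₁ b₂ q := by positivity
      nlinarith
  have hpos := mlgWeight_pos (q := q) (Δ := Δ) hθ hb₁ hb₂
  refine ⟨by positivity, fun h0 => ?_, fun h2 => ?_, fun h1 => ?_, fun h1 => ?_⟩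
  · simp [mlgWeight, mlgPeriod, h0]
    apply le_of_eq
    ring
  · have h0 : Δ ≠ 0 := by omega
    have h1 : Δ ≠ 1 := by omega
    have h3 : (Δ : ℝ) ≠ 0 := by exact_mod_cast h0
    simp only [mlgWeight, mlgPeriod, h0, h1, if_false]
    apply le_of_eq
    field_simp
  · by_cases h2 : Δ = 1
    · subst h2
      simp only [mlgWeight, mlgPeriod, if_true, one_ne_zero, if_false]
      push_cast
      apply le_of_eq
      ring
    · have h0 : Δ ≠ 0 := by omega
      have h3 : (0 : ℝ) < Δ := by positivity
      have h4 := hcrit (by omega)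
      simp only [mlgWeight, mlgPeriod, h0, h2, if_false]
      rw [mul_div_assoc', div_le_iff₀ h3]
      nlinarith
  · have he : 1 ≤ Real.exp θ := by linarith
    by_cases h2 : Δ = 1
    · subst h2
      simp only [mlgWeight, mlgPeriod, if_true, one_ne_zero, if_false]
      push_cast
      have h3 : b₂ ^ (q + 1) ≤ Real.exp θ * b₂ ^ (q + 1) := le_mul_of_one_le_left (by positivity) he
      have h4 : 0 < b₁ * homSum b₁ b₂ q := by positivity
      have h5 : (1 + 2) * ((b₁ ^ (q + 1) + b₂ * homSum b₁ b₂ q) / 2) ≤ b₁ ^ (q + 1)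
          + b₁ * homSum b₁ b₂ q + b₂ * (homSum b₁ b₂ q + Real.exp θ * b₂ ^ q) := by
        have h6 : b₂ * (homSum b₁ b₂ q + Real.exp θ * b₂ ^ q) =
          b₂ * homSum b₁ b₂ q + Real.exp θ * b₂ ^ (q + 1) := by ring
        have h7 : 0 < b₂ ^ (q + 1) := by positivity
        rw [h6]
        linarith
      calc _ = (1 + 2) * ((b₁ ^ (q + 1) + b₂ * homSum b₁ b₂ q) / 2) * (Real.exp θ - 1) := by ring
        _ ≤ _ := mul_le_mul_of_nonneg_right h5 hc.le
    · have h0 : Δ ≠ 0 := by omega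
      have h3 : (2 : ℝ) ≤ Δ := by exact_mod_cast (by omega : 2 ≤ Δ)
      have h4 := hcrit (by omega)
      simp only [mlgWeight, mlgPeriod, h0, h2, if_false]
      rw [mul_div_assoc', div_le_iff₀ (by linarith)]
      have h6 : 0 < b₂ * (Real.exp θ * b₂ ^ q) := by positivity
      have h8 : 0 < b₁ ^ (q + 1) := by positivity
      have h7 : (Δ + 2) * b₁ ^ (q + 1) ≤ (b₁ ^ (q + 1) + b₁ * homSum b₁ b₂ q
          + b₂ * (homSum b₁ b₂ q + Real.exp θ * b₂ ^ q)) * Δ := by nlinarith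
      calc _ = (Δ + 2) * b₁ ^ (q + 1) * (Real.exp θ - 1) := by ring
        _ ≤ _ := mul_le_mul_of_nonneg_right h7 hc.le
        _ = _ := by ring

lemma IsCycleRate.mono {β β' : ℝ} (h : IsCycleRate θ b₁ b₂ q Δ β) (h0 : 0 ≤ β') (hle : β' ≤ β) :
    IsCycleRate θ b₁ b₂ q Δ β' where
  nonneg := h0
  equal hΔ := by linarith [h.equal hΔ]
  short hΔ := (mul_le_mul_of_nonneg_left hle (by positivity)).trans (h.short hΔ)
  diag hΔ := (mul_le_mul_of_nonneg_left hle (by positivity)).trans (h.diag hΔ)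
  long hΔ := (mul_le_mul_of_nonneg_left hle (by positivity)).trans (h.long hΔ)

/-- For `Δ ≤ 1` the MLG rate is inherited or decreased. For `Δ ≥ 2` the three terms of `A₂` are the
three cycle ratios, with `homSum` bounded through the smaller rate where `A₂` contains it and the
e^θ term dropped. -/
lemma isCycleRate_lowerCoeff (hθ : 0 < θ) (hb₁ : 0 < b₁) (hb₂ : 0 < b₂) :
    IsCycleRate θ b₁ b₂ q Δ (lowerCoeff θ b₁ b₂ (q + 2) Δ * θ) := by
  have hc : 0 < Real.exp θ - 1 := by linarith [Real.add_one_lt_exp hθ.ne']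
  have hH := homSum_pos hb₁ hb₂ q
  have hm : 0 < min b₁ b₂ := lt_min hb₁ hb₂
  have hn : ((q + 2 : ℕ) : ℝ) - 1 = (q : ℝ) + 1 := by push_cast; ring
  have hm2 := mul_homSum_le hb₁ hb₂ (min_le_right b₁ b₂) q
  have hm1 := mul_homSum_le hb₁ hb₂ (min_le_left b₁ b₂) q
  by_cases h2 : Δ ≤ 1
  · have h := isCycleRate_mlg (q := q) (Δ := Δ) hθ hb₁ hb₂ (by omega)
    have e : mlgWeight θ b₁ b₂ q Δ / mlgPeriod Δ = mlgCoeff θ b₁ b₂ (q + 2) Δ * θ := by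
      rw [mlgCoeff_eq hθ]; field_simp
    rw [e] at h
    unfold lowerCoeff
    split_ifs with h0 h1
    · simpa [mlgCoeff, h0] using h
    · refine h.mono ?_ ?_
      · rw [A₁, hn]
        positivity
      · simp only [mlgCoeff, h1, one_ne_zero, if_true, if_false]
        have e2 := homSum_succ' b₁ b₂ q
        rw [homSum] at e2
        rw [A₁, hn, show q + 2 - 1 = q + 1 from rfl, e2]
        gcongr
    · omega
  · have h0 : Δ ≠ 0 := by omega
    have h1 : Δ ≠ 1 := by omega
    have hΔ : (0 : ℝ) < Δ := by positivity
    have e : lowerCoeff θ b₁ b₂ (q + 2) Δ * θ = A₂ b₁ b₂ (q + 2) Δ * (Real.exp θ - 1) := by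
      simp only [lowerCoeff, h0, h1, if_false]
      field_simp
    rw [e]
    have a1 : A₂ b₁ b₂ (q + 2) Δ ≤ b₁ ^ (q + 1) / Δ := min_le_left _ _
    have a2 : A₂ b₁ b₂ (q + 2) Δ ≤
        (b₁ ^ (q + 1) + ((q : ℝ) + 1) * min b₁ b₂ ^ (q + 1)) / (Δ + 1) := by
      rw [← hn]
      exact (min_le_right _ _).trans (min_le_left _ _)
    have a3 : A₂ b₁ b₂ (q + 2) Δ ≤
        (b₁ ^ (q + 1) + ((q : ℝ) + 1) * min b₁ b₂ ^ (q + 1)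
          + b₂ * homSum b₁ b₂ q) / (Δ + 2) := by
      rw [← hn, ← sum_Icc_eq_mul_homSum]
      exact (min_le_right _ _).trans (min_le_right _ _)
    have a0 : 0 ≤ A₂ b₁ b₂ (q + 2) Δ := by
      rw [A₂, hn, show q + 2 - 1 = q + 1 from rfl, sum_Icc_eq_mul_homSum]
      refine le_min ?_ (le_min ?_ ?_) <;> positivity
    rw [le_div_iff₀ (by positivity)] at a1 a2 a3
    refine ⟨mul_nonneg a0 hc.le, fun h => absurd h h0, fun _ => ?_, fun _ => ?_, fun _ => ?_⟩
    · rw [← mul_assoc]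
      exact mul_le_mul_of_nonneg_right (by linarith) hc.le
    · rw [← mul_assoc]
      exact mul_le_mul_of_nonneg_right (by linarith) hc.le
    · rw [← mul_assoc]
      have : 0 < b₂ * (Real.exp θ * b₂ ^ q) := by positivity
      exact mul_le_mul_of_nonneg_right (by linarith) hc.le

end coefficients

/-! ### Assembly of the three claims -/

section main
variable {θ b₁ b₂ : ℝ} {q Δ : ℕ}

lemma avgCost_mlg_isBigO (hθ : 0 < θ) (hb₁ : 0 < b₁) (hb₂ : 0 < b₂)
    (x : State (q + 2) (q + 2 + Δ)) :
    (fun ε : ℝ => avgCost θ (reliability b₁ b₂ ε) (mlg (q + 2) Δ) x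
      - mlgCoeff θ b₁ b₂ (q + 2) Δ * ε ^ (q + 1)) =O[𝓝[>] 0] fun ε : ℝ => ε ^ (q + 2) := by
  rw [mlgCoeff_eq hθ]
  refine avgCost_isBigO_of_growthError (n := q + 1) hθ hb₁ hb₂ q.succ_pos (mlgPeriod_pos Δ) _ ?_ x
  simp only [mlg_truncate]
  exact growthError_isBigO_of_iterate ⟨q + 2, fun N hN => safe_mlg.growthError_isBigO hθ
    (rate_pos hb₁ hb₂) q.succ_pos (lead_mlg_period hN)⟩ (exists_iterate_mlg q Δ)

lemma optCost_le_avgCost (p : Client → ℝ) {τ₁ τ₂ : ℕ} (f : Policy τ₁ τ₂) (x : State τ₁ τ₂) :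
    optCost θ p x ≤ avgCost θ p f x :=
  ciInf_le (Set.finite_range _).bddBelow f

lemma exists_littleO_le_optCost (hθ : 0 < θ) (hb₁ : 0 < b₁) (hb₂ : 0 < b₂)
    (x : State (q + 2) (q + 2 + Δ)) :
    ∃ r : ℝ → ℝ, (r =o[𝓝[>] 0] fun ε : ℝ => ε ^ (q + 1)) ∧
      ∀ᶠ ε : ℝ in 𝓝[>] 0, lowerCoeff θ b₁ b₂ (q + 2) Δ * ε ^ (q + 1) + r ε
        ≤ optCost θ (reliability b₁ b₂ ε) x := by
  -- The remainder is the negative part of the difference, so only a lower estimate is needed to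
  -- show that it is negligible.
  refine ⟨fun ε => min 0 (optCost θ (reliability b₁ b₂ ε) x
    - lowerCoeff θ b₁ b₂ (q + 2) Δ * ε ^ (q + 1)), ?_, Eventually.of_forall fun ε => ?_⟩
  · refine isLittleO_iff.2 fun c hc => ?_
    filter_upwards [eventually_le_optCost hθ hb₁ hb₂ (isCycleRate_lowerCoeff hθ hb₁ hb₂) x
      (mul_pos hc hθ), self_mem_nhdsWithin] with ε h hε
    have hε' : 0 < ε := hε
    rw [← sub_mul, mul_div_cancel_right₀ _ hθ.ne', sub_mul] at h
    have h1 : 0 < c * ε ^ (q + 1) := by positivity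
    rw [Real.norm_of_nonneg (by positivity : 0 ≤ ε ^ (q + 1)), Real.norm_eq_abs,
      abs_of_nonpos (min_le_left _ _), neg_le]
    exact le_min (by linarith) (by linarith)
  · linarith [min_le_right 0 (optCost θ (reliability b₁ b₂ ε) x
      - lowerCoeff θ b₁ b₂ (q + 2) Δ * ε ^ (q + 1))]

lemma tendsto_avgCost_mlg_div_optCost (hθ : 0 < θ) (hb₁ : 0 < b₁) (hb₂ : 0 < b₂)
    (h : 2 ≤ Δ → b₁ ^ (q + 1) ≤ Δ * ((q : ℝ) + 1) * b₂ ^ (q + 1))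
    (x : State (q + 2) (q + 2 + Δ)) :
    Tendsto (fun ε : ℝ => avgCost θ (reliability b₁ b₂ ε) (mlg (q + 2) Δ) x
      / optCost θ (reliability b₁ b₂ ε) x) (𝓝[>] 0) (𝓝 1) := by
  have hγ : 0 < mlgCoeff θ b₁ b₂ (q + 2) Δ := by
    rw [mlgCoeff_eq hθ]
    have h1 := mlgWeight_pos (q := q) (Δ := Δ) hθ hb₁ hb₂
    have h2 := mlgPeriod_pos Δ
    positivity
  have hrate := isCycleRate_mlg hθ hb₁ hb₂ h
  rw [show mlgWeight θ b₁ b₂ q Δ / mlgPeriod Δ = mlgCoeff θ b₁ b₂ (q + 2) Δ * θ by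
    rw [mlgCoeff_eq hθ]; field_simp] at hrate
  set γ := mlgCoeff θ b₁ b₂ (q + 2) Δ
  set J := fun ε : ℝ => avgCost θ (reliability b₁ b₂ ε) (mlg (q + 2) Δ) x with hJ
  set O := fun ε : ℝ => optCost θ (reliability b₁ b₂ ε) x with hO
  have tJ : Tendsto (fun ε => J ε / ε ^ (q + 1)) (𝓝[>] 0) (𝓝 γ) := by
    have h1 := ((avgCost_mlg_isBigO hθ hb₁ hb₂ x).trans_isLittleO ((isLittleO_pow_pow (𝕜 := ℝ)
      (Nat.lt_succ_self (q + 1))).mono nhdsWithin_le_nhds)).tendsto_div_nhds_zero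
    have h2 := h1.add_const γ
    rw [zero_add] at h2
    refine h2.congr' ?_
    filter_upwards [self_mem_nhdsWithin] with ε hε
    have hε' : ε ≠ 0 := ne_of_gt hε
    field_simp
    simp only [hJ]
    ring
  -- The normalised optimal cost is squeezed between the cycle-rate bound and the MLG cost itself.
  have tO : Tendsto (fun ε => O ε / ε ^ (q + 1)) (𝓝[>] 0) (𝓝 γ) := by
    rw [tendsto_order]
    refine ⟨fun a ha => ?_, fun a ha => ?_⟩
    · filter_upwards [eventually_le_optCost hθ hb₁ hb₂ hrate x
        (δ := (γ - a) / 2 * θ) (mul_pos (by linarith) hθ), self_mem_nhdsWithin] with ε h hε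
      have hε' : 0 < ε := hε
      rw [← sub_mul, mul_div_cancel_right₀ _ hθ.ne'] at h
      rw [lt_div_iff₀ (by positivity)]
      refine lt_of_lt_of_le ?_ h
      gcongr
      linarith
    · filter_upwards [tJ.eventually_lt_const ha, self_mem_nhdsWithin] with ε h hε
      have hε' : 0 < ε := hε
      refine lt_of_le_of_lt ?_ h
      gcongr
      exact optCost_le_avgCost _ _ _
  have := tJ.div tO hγ.ne'
  rw [div_self hγ.ne'] at this
  refine this.congr' ?_
  filter_upwards [self_mem_nhdsWithin] with ε hε
  have hε' : 0 < ε := hε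
  exact div_div_div_cancel_right₀ (by positivity) _ _

end main
end InterDelivery
end

open InterDelivery in
theorem theorem3 (θ b₁ b₂ : ℝ) (hθ : 0 < θ) (hb₁ : 0 < b₁) (hb₂ : 0 < b₂)
    (τ Δ : ℕ) (hτ : 2 ≤ τ) (x : State τ (τ + Δ)) :
    -- 1) the cost of the MLG policy
    ((fun ε : ℝ => avgCost θ (reliability b₁ b₂ ε) (mlg τ Δ) x
        - mlgCoeff θ b₁ b₂ τ Δ * ε ^ (τ - 1)) =O[𝓝[>] 0] fun ε : ℝ => ε ^ τ) ∧
    -- 2) the lower bound on the optimal cost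
    (∃ r : ℝ → ℝ, (r =o[𝓝[>] 0] fun ε : ℝ => ε ^ (τ - 1)) ∧
      ∀ᶠ ε : ℝ in 𝓝[>] 0, lowerCoeff θ b₁ b₂ τ Δ * ε ^ (τ - 1) + r ε
        ≤ optCost θ (reliability b₁ b₂ ε) x) ∧
    -- 3) asymptotic optimality of the MLG policy
    ((Δ = 0 ∨ (Δ = 1 ∧ b₁ ≤ b₂) ∨
        (2 ≤ Δ ∧ b₁ ^ (τ - 1) ≤ (Δ : ℝ) * ((τ : ℝ) - 1) * b₂ ^ (τ - 1))) →
      Tendsto (fun ε : ℝ => avgCost θ (reliability b₁ b₂ ε) (mlg τ Δ) x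
        / optCost θ (reliability b₁ b₂ ε) x) (𝓝[>] 0) (𝓝 1)) := by
  obtain ⟨q, rfl⟩ : ∃ q, τ = q + 2 := ⟨τ - 2, by omega⟩
  refine ⟨avgCost_mlg_isBigO hθ hb₁ hb₂ x, exists_littleO_le_optCost hθ hb₁ hb₂ x, fun h => ?_⟩
  refine tendsto_avgCost_mlg_div_optCost hθ hb₁ hb₂ (fun hΔ => ?_) x
  rcases h with h | h | h
  · omega
  · omega
  · have hn : ((q + 2 : ℕ) : ℝ) - 1 = (q : ℝ) + 1 := by push_cast; ring
    have := h.2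
    rwa [hn] at this
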